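/- For $x\in\mathbb{R}$ let $\|x\|$ denote the distance from $x$ to the nearest integer. For real numbers $s,t\ge 0$ with $s+t=1$, let $$\mathrm{Bad}(s,t)=\Big\{(x,y)\in\mathbb{R}^2:\ \inf_{q\in\mathbb{N},\,q\ge 1}\max\{q^{s}\|qx\|,\;q^{t}\|qy\|\}>0\Big\}.$$ Let $(s_n,t_n)_{n=1}^\infty$ be a sequence of pairs of nonnegative real numbers with $s_n+t_n=1$ for all $n$, and let $(f_n)_{n=1}^\infty$ be a sequence of uniformly bi-Lipschitz homeomorphisms of $\mathbb{R}^2$ onto itself, that is, there exists $M\ge 1$ such that $$M^{-1}|\mathbf{x}_1-\mathbf{x}_2|\le |f_n(\mathbf{x}_1)-f_n(\mathbf{x}_2)|\le M|\mathbf{x}_1-\mathbf{x}_2|\qquad\text{for all }\mathbf{x}_1,\mathbf{x}_2\in\mathbb{R}^2,\ n\ge 1,$$ where $|\cdot|$ is the Euclidean norm. Then the set $\bigcap_{n=1}^\infty f_n(\mathrm{Bad}(s_n,t_n))$ has full Hausdorff dimension in $\mathbb{R}^2$, i.e. its Hausdorff dimension is $2$. In particular, Schmidt's conjecture holds: $\mathrm{Bad}(\tfrac13,\tfrac23)\cap\mathrm{Bad}(\tfrac23,\tfrac13)\ne\emptyset$.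 -/

import Mathlib

/-- The distance of a real number to the nearest integer. -/
noncomputable def distNearestInt (x : ℝ) : ℝ := |x - round x|

/-- The set of `(s, t)`-badly approximable vectors of the Euclidean plane: those `(x, y)` for which
the infimum over positive integers `q` of `max (q ^ s * ‖q x‖) (q ^ t * ‖q y‖)` is positive, where
`‖·‖` is the distance to the nearest integer. The family is indexed by a nonempty type and bounded
below by `0`, so the real infimum is the genuine one. -/
def Bad (s t : ℝ) : Set (EuclideanSpace ℝ (Fin 2)) :=
  {v | 0 < ⨅ q : ℕ+,
    max (((q : ℕ) : ℝ) ^ s * distNearestInt (((q : ℕ) : ℝ) * v 0))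
      (((q : ℕ) : ℝ) ^ t * distNearestInt (((q : ℕ) : ℝ) * v 1))}

/-!
The argument is a potential-theoretic version of An's proof of Schmidt's conjecture.

*Rational points.* Attach to every rational point `P = (p / q, r / q)` an integral line
`A x + B y + C = 0` through it with `|A| ≤ q ^ s` and `|B| ≤ q ^ t` (`RatLine.exists_pt_eq`); by
symmetry, let `s ≤ t`. A vector is in `Bad s t` as soon as it avoids, for some `ε > 0`, all boxes
around the points `P` with sides of the order of `ε q ^ (-1 - s)` and `ε q ^ (-1 - t)`. Such a box
lies in the strip of width `2 ε / H` around the line of `P`, where `H = q M` and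
`M = max |A| |B|`. Points are classified by `H`, which determines the width `R ^ (-(n + k + 1))` of
the strip, and by `g = q ^ s M`, which determines the scale `R ^ (-n)` at which the point is taken
care of (`RatLine.InClass`).

The arithmetic input is `RatLine.exists_strip`: a set `X` of diameter of the order of `R ^ (-n)`
which avoids the boxes of all points of smaller height meets the boxes of each class `(n, k)` within
one single strip. Indeed, were two different lines of the class relevant for `X`, then their
intersection point would be rational with a denominator so small that its own box would contain
`X`. For `k = 0` one compares denominators instead: each line passes through the points of the
others. The result is recorded in a form which no longer mentions rational points, as
`StripProperty`.

*Cells.* Divide the plane into squares of side `R ^ (-n)`. The image of a strip of width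
`R ^ (-N)` under a bi-Lipschitz map meets only `O(R ^ (N - n))` of the `R ^ (2 (N - n))` cells of
level `N` below a given cell of level `n` (`measure_cellsMeeting_image_le`). Give an obstacle of
level `N` the mass `lam ^ (-N)`, with `lam = R ^ d` and `1 < d < 2`. Choosing at each level a child
whose mass of obstacles is at most the average keeps the mass below the current cell under control,
and `exists_path_avoiding` yields a point which avoids all obstacles. Countably many maps are
handled at once by using the base `R ^ (j + 1)` for the `j`-th one, so that the masses sum up.

*Dimension.* If the intersection had vanishing `d`-dimensional Hausdorff measure, it would have a
cover whose sum of `d`-th powers of diameters is as small as desired. The members of the cover can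
then be treated as additional obstacles of small total mass, and the path leads to a point of the
intersection outside the cover.
-/

open MeasureTheory
open scoped ENNReal

/-! ### Rational points and attached rational lines -/

/-- The common denominator of the coordinates of a rational point of the plane. -/
def ratDen (P : ℚ × ℚ) : ℕ := Nat.lcm P.1.den P.2.den

lemma ratDen_pos (P : ℚ × ℚ) : 0 < ratDen P :=
  Nat.lcm_pos P.1.den_pos P.2.den_pos

lemma exists_int_eq_mul_of_den_dvd (x : ℚ) (q : ℕ) (h : x.den ∣ q) :
    ∃ p : ℤ, (q : ℚ) * x = p := by
  obtain ⟨e, rfl⟩ := h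
  refine ⟨e * x.num, ?_⟩
  push_cast
  rw [mul_comm (x.den : ℚ) e, mul_assoc, Rat.den_mul_eq_num]

lemma ratDen_le_of_mul_eq (x y : ℚ) (d u v : ℤ) (hd : d ≠ 0) (hx : (d : ℚ) * x = u)
    (hy : (d : ℚ) * y = v) : ratDen (x, y) ≤ d.natAbs := by
  have hd' : (d : ℚ) ≠ 0 := by exact_mod_cast hd
  have key : ∀ (z : ℚ) (w : ℤ), (d : ℚ) * z = w → z.den ∣ d.natAbs := by
    intro z w h
    have : z = (w : ℚ) / d := by field_simp; linarith
    rw [this, ← Int.natCast_dvd]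
    rw [← Rat.divInt_eq_div]
    exact Rat.den_dvd w d
  exact Nat.le_of_dvd (Int.natAbs_pos.mpr hd) (Nat.lcm_dvd (key x u hx) (key y v hy))

/-- A rational point `pt` of common denominator `q`, together with an integral line
`A x + B y + C = 0` through it whose coefficients satisfy `|A| ≤ q ^ s` and `|B| ≤ q ^ t`. -/
structure RatLine (s t : ℝ) where
  /-- the rational point -/
  pt : ℚ × ℚ
  /-- the coefficient of the first coordinate -/
  A : ℤ
  /-- the coefficient of the second coordinate -/
  B : ℤ
  /-- the constant coefficient -/
  C : ℤ
  ne : A ≠ 0 ∨ B ≠ 0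
  absA : |(A : ℝ)| ≤ (ratDen pt : ℝ) ^ s
  absB : |(B : ℝ)| ≤ (ratDen pt : ℝ) ^ t
  eq_zero : (A : ℚ) * pt.1 + B * pt.2 + C = 0

/-- Every rational point lies on such a line: the box `0 ≤ a ≤ q ^ s`, `0 ≤ b ≤ q ^ t` contains more
than `q` integral points, so that two of them agree under `(a, b) ↦ a p + b r` modulo `q`. -/
lemma RatLine.exists_pt_eq {s t : ℝ} (hst : s + t = 1) (P : ℚ × ℚ) :
    ∃ ℓ : RatLine s t, ℓ.pt = P := by
  have hq := ratDen_pos P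
  set q := ratDen P with hqdef
  have hqr : (0 : ℝ) < q := by exact_mod_cast hq
  obtain ⟨p, hp⟩ := exists_int_eq_mul_of_den_dvd P.1 q (Nat.dvd_lcm_left _ _)
  obtain ⟨r, hr⟩ := exists_int_eq_mul_of_den_dvd P.2 q (Nat.dvd_lcm_right _ _)
  set a := ⌊(q : ℝ) ^ s⌋₊
  set b := ⌊(q : ℝ) ^ t⌋₊
  have ha : (q : ℝ) ^ s < a + 1 := Nat.lt_floor_add_one _
  have hb : (q : ℝ) ^ t < b + 1 := Nat.lt_floor_add_one _
  have hcard : q < (a + 1) * (b + 1) := by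
    have h1 : (q : ℝ) = (q : ℝ) ^ s * (q : ℝ) ^ t := by
      rw [← Real.rpow_add hqr, hst, Real.rpow_one]
    have h2 : (q : ℝ) < (a + 1) * (b + 1) := by
      rw [h1]
      exact mul_lt_mul'' ha hb (by positivity) (by positivity)
    exact_mod_cast h2
  have : NeZero q := ⟨hq.ne'⟩
  obtain ⟨u, hu, v, hv, huv, he⟩ := Finset.exists_ne_map_eq_of_card_lt_of_maps_to
    (s := Finset.range (a + 1) ×ˢ Finset.range (b + 1)) (t := (Finset.univ : Finset (ZMod q)))
    (f := fun z => ((z.1 * p + z.2 * r : ℤ) : ZMod q))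
    (by simpa [ZMod.card] using hcard) (by intro x _; simp)
  simp only [Finset.mem_product, Finset.mem_range] at hu hv
  rw [ZMod.intCast_eq_intCast_iff_dvd_sub] at he
  obtain ⟨c, hc⟩ := he
  have bound : ∀ (m n e : ℕ), m < e + 1 → n < e + 1 → |(((n : ℤ) - m : ℤ) : ℝ)| ≤ e := by
    intro m n e h1 h2
    have : |((n : ℤ) - m : ℤ)| ≤ e := by rw [abs_le]; omega
    exact_mod_cast this
  refine ⟨⟨P, (v.1 : ℤ) - u.1, (v.2 : ℤ) - u.2, -c, ?_, ?_, ?_, ?_⟩, rfl⟩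
  · by_contra! h
    exact huv (Prod.ext (by omega) (by omega))
  · exact (bound _ _ _ hu.1 hv.1).trans (Nat.floor_le (by positivity))
  · exact (bound _ _ _ hu.2 hv.2).trans (Nat.floor_le (by positivity))
  · have hq0 : (q : ℚ) ≠ 0 := by exact_mod_cast hq.ne'
    have hc' : ((v.1 : ℚ) * p + v.2 * r) - (u.1 * p + u.2 * r) = q * c := by exact_mod_cast hc
    rw [← hp, ← hr] at hc'
    push_cast
    apply mul_left_cancel₀ hq0
    linear_combination hc'

namespace RatLine

variable {s t : ℝ} (ℓ : RatLine s t)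

/-- The denominator of the point of `ℓ`. -/
def q : ℝ := ratDen ℓ.pt

/-- The size of the normal vector of `ℓ`. -/
noncomputable def M : ℝ := max |(ℓ.A : ℝ)| |(ℓ.B : ℝ)|

/-- The height of `ℓ`; a box of size `ε q ^ (-1 - s)` by `ε q ^ (-1 - t)` around the point is
contained in the strip of width `2 ε / H` around the line. -/
noncomputable def H : ℝ := ℓ.q * ℓ.M

/-- The quantity bounding the determinant of two lines of comparable invariants. -/
noncomputable def g : ℝ := ℓ.q ^ s * ℓ.M

/-- The affine form defining the line. -/
def form (v : ℝ × ℝ) : ℝ := ℓ.A * v.1 + ℓ.B * v.2 + ℓ.C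

/-- The box of points that are approximated too well by the point of `ℓ`. -/
def box (ε : ℝ) : Set (ℝ × ℝ) :=
  {v | |v.1 - ℓ.pt.1| ≤ ε / ℓ.q ^ (1 + s) ∧ |v.2 - ℓ.pt.2| ≤ ε / ℓ.q ^ (1 + t)}

lemma one_le_q : 1 ≤ ℓ.q := by
  unfold q; exact_mod_cast ratDen_pos ℓ.pt

lemma q_pos : 0 < ℓ.q := zero_lt_one.trans_le ℓ.one_le_q

lemma one_le_M : 1 ≤ ℓ.M := by
  rcases ℓ.ne with h | h
  · exact le_max_of_le_left (by exact_mod_cast Int.one_le_abs h)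
  · exact le_max_of_le_right (by exact_mod_cast Int.one_le_abs h)

lemma M_pos : 0 < ℓ.M := zero_lt_one.trans_le ℓ.one_le_M

lemma H_pos : 0 < ℓ.H := mul_pos ℓ.q_pos ℓ.M_pos

lemma one_le_H : 1 ≤ ℓ.H := one_le_mul_of_one_le_of_one_le ℓ.one_le_q ℓ.one_le_M

lemma absA_le_M : |(ℓ.A : ℝ)| ≤ ℓ.M := le_max_left _ _

lemma absB_le_M : |(ℓ.B : ℝ)| ≤ ℓ.M := le_max_right _ _

lemma absA_le_q : |(ℓ.A : ℝ)| ≤ ℓ.q ^ s := ℓ.absA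

lemma absB_le_q : |(ℓ.B : ℝ)| ≤ ℓ.q ^ t := ℓ.absB

lemma M_le (h : s ≤ t) : ℓ.M ≤ ℓ.q ^ t :=
  max_le (ℓ.absA.trans (Real.rpow_le_rpow_of_exponent_le ℓ.one_le_q h)) ℓ.absB

lemma one_le_g (hs : 0 ≤ s) : 1 ≤ ℓ.g :=
  one_le_mul_of_one_le_of_one_le (Real.one_le_rpow ℓ.one_le_q hs) ℓ.one_le_M

lemma g_pos (hs : 0 ≤ s) : 0 < ℓ.g := zero_lt_one.trans_le (ℓ.one_le_g hs)

lemma q_rpow_mul_g (hst : s + t = 1) : ℓ.q ^ t * ℓ.g = ℓ.H := by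
  unfold g H
  rw [← mul_assoc, ← Real.rpow_add ℓ.q_pos, add_comm t, hst, Real.rpow_one]

lemma g_le_q (hst : s + t = 1) (h : s ≤ t) : ℓ.g ≤ ℓ.q := by
  unfold g
  calc ℓ.q ^ s * ℓ.M ≤ ℓ.q ^ s * ℓ.q ^ t :=
        mul_le_mul_of_nonneg_left (ℓ.M_le h) (Real.rpow_nonneg ℓ.q_pos.le _)
    _ = ℓ.q := by rw [← Real.rpow_add ℓ.q_pos, hst, Real.rpow_one]

lemma g_rpow_le_H (hs : 0 ≤ s) (hst : s + t = 1) (h : s ≤ t) : ℓ.g ^ (1 + t) ≤ ℓ.H := by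
  rw [Real.rpow_add (ℓ.g_pos hs), Real.rpow_one, mul_comm, ← ℓ.q_rpow_mul_g hst]
  exact mul_le_mul_of_nonneg_right
    (Real.rpow_le_rpow (ℓ.g_pos hs).le (ℓ.g_le_q hst h) (by linarith)) (ℓ.g_pos hs).le

lemma M_le_g_rpow (hs : 0 ≤ s) (hst : s + t = 1) (h : s ≤ t) : ℓ.M ≤ ℓ.g ^ t := by
  have h1 : ℓ.M ^ s ≤ (ℓ.q ^ s) ^ t := by
    rw [← Real.rpow_mul ℓ.q_pos.le, mul_comm s t, Real.rpow_mul ℓ.q_pos.le]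
    exact Real.rpow_le_rpow ℓ.M_pos.le (ℓ.M_le h) hs
  calc ℓ.M = ℓ.M ^ s * ℓ.M ^ t := by rw [← Real.rpow_add ℓ.M_pos, hst, Real.rpow_one]
    _ ≤ (ℓ.q ^ s) ^ t * ℓ.M ^ t :=
        mul_le_mul_of_nonneg_right h1 (Real.rpow_nonneg ℓ.M_pos.le _)
    _ = ℓ.g ^ t := by
        unfold g
        rw [Real.mul_rpow (Real.rpow_nonneg ℓ.q_pos.le _) ℓ.M_pos.le]

lemma M_sq_mul_g_rpow_le (hs : 0 ≤ s) (hst : s + t = 1) (h : s ≤ t) :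
    ℓ.M * ℓ.M * ℓ.g ^ s ≤ ℓ.g ^ (1 + t) := by
  have h0 := ℓ.M_le_g_rpow hs hst h
  have hg := ℓ.g_pos hs
  calc ℓ.M * ℓ.M * ℓ.g ^ s ≤ ℓ.g ^ t * ℓ.g ^ t * ℓ.g ^ s := by
        gcongr
        exact ℓ.M_pos.le
    _ = ℓ.g ^ (1 + t) := by
        rw [← Real.rpow_add hg, ← Real.rpow_add hg]
        congr 1; linarith

lemma eq_zero_real : (ℓ.A : ℝ) * ℓ.pt.1 + ℓ.B * ℓ.pt.2 + ℓ.C = 0 := by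
  exact_mod_cast congrArg (fun x : ℚ => (x : ℝ)) ℓ.eq_zero

lemma abs_form_sub_le (v w : ℝ × ℝ) (d : ℝ) (h1 : |v.1 - w.1| ≤ d) (h2 : |v.2 - w.2| ≤ d) :
    |ℓ.form v - ℓ.form w| ≤ 2 * ℓ.M * d := by
  have : ℓ.form v - ℓ.form w = ℓ.A * (v.1 - w.1) + ℓ.B * (v.2 - w.2) := by unfold form; ring
  rw [this]
  have hd : 0 ≤ d := (abs_nonneg _).trans h1
  calc _ ≤ |(ℓ.A : ℝ)| * |v.1 - w.1| + |(ℓ.B : ℝ)| * |v.2 - w.2| := by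
        rw [← abs_mul, ← abs_mul]; exact abs_add_le _ _
    _ ≤ ℓ.M * d + ℓ.M * d := by
        have := ℓ.absA_le_M
        have := ℓ.absB_le_M
        have := ℓ.M_pos
        gcongr
    _ = _ := by ring

/-- On the box of a point `ℓ'`, the form of `ℓ` is close to its value at that point. -/
lemma abs_form_sub_pt_le (ℓ' : RatLine s t) {ε c : ℝ} (hε : 0 ≤ ε) (hs : 0 ≤ s) (ht : 0 ≤ t)
    (hs1 : s ≤ 1) (ht1 : t ≤ 1) (hc : 1 ≤ c) (hq : ℓ.q ≤ c * ℓ'.q) {v : ℝ × ℝ}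
    (hv : v ∈ ℓ'.box ε) :
    |ℓ.form v - ℓ.form (ℓ'.pt.1, ℓ'.pt.2)| ≤ 2 * c * ε / ℓ'.q := by
  have : ℓ.form v - ℓ.form (ℓ'.pt.1, ℓ'.pt.2)
      = ℓ.A * (v.1 - ℓ'.pt.1) + ℓ.B * (v.2 - ℓ'.pt.2) := by unfold form; ring
  rw [this]
  have key : ∀ u : ℝ, 0 ≤ u → u ≤ 1 → ℓ.q ^ u * (ε / ℓ'.q ^ (1 + u)) ≤ c * ε / ℓ'.q := by
    intro u hu hu1
    have hq' := ℓ'.q_pos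
    have h1 : ℓ.q ^ u ≤ c * ℓ'.q ^ u :=
      calc ℓ.q ^ u ≤ (c * ℓ'.q) ^ u := Real.rpow_le_rpow ℓ.q_pos.le hq hu
        _ = c ^ u * ℓ'.q ^ u := Real.mul_rpow (by linarith) hq'.le
        _ ≤ c * ℓ'.q ^ u := by
          gcongr
          simpa using Real.rpow_le_rpow_of_exponent_le hc hu1
    rw [Real.rpow_add hq', Real.rpow_one]
    have h2 := Real.rpow_pos_of_pos hq' u
    calc ℓ.q ^ u * (ε / (ℓ'.q * ℓ'.q ^ u)) ≤ c * ℓ'.q ^ u * (ε / (ℓ'.q * ℓ'.q ^ u)) := by gcongr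
      _ = c * ε / ℓ'.q := by field_simp
  calc _ ≤ |(ℓ.A : ℝ)| * |v.1 - ℓ'.pt.1| + |(ℓ.B : ℝ)| * |v.2 - ℓ'.pt.2| := by
        rw [← abs_mul, ← abs_mul]; exact abs_add_le _ _
    _ ≤ ℓ.q ^ s * (ε / ℓ'.q ^ (1 + s)) + ℓ.q ^ t * (ε / ℓ'.q ^ (1 + t)) := by
        have := ℓ.absA_le_q
        have := ℓ.absB_le_q
        have := hv.1
        have := hv.2
        have := ℓ.q_pos
        gcongr
    _ ≤ c * ε / ℓ'.q + c * ε / ℓ'.q := add_le_add (key s hs hs1) (key t ht ht1)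
    _ = _ := by ring

lemma form_pt : ℓ.form (ℓ.pt.1, ℓ.pt.2) = 0 := ℓ.eq_zero_real

lemma abs_form_le_of_mem_box {ε : ℝ} (hε : 0 ≤ ε) (hs : 0 ≤ s) (ht : 0 ≤ t)
    (hst : s + t = 1) {v : ℝ × ℝ} (hv : v ∈ ℓ.box ε) : |ℓ.form v| ≤ 2 * ε / ℓ.q := by
  have := ℓ.abs_form_sub_pt_le ℓ hε hs ht (by linarith) (by linarith) le_rfl
    (by linarith) hv
  rwa [form_pt, sub_zero, mul_one] at this

/-- Proportionality of the coefficient vectors of two lines. -/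
def Same (ℓ ℓ' : RatLine s t) : Prop :=
  (ℓ.A : ℝ) * ℓ'.B = ℓ'.A * ℓ.B ∧ (ℓ.A : ℝ) * ℓ'.C = ℓ'.A * ℓ.C ∧
    (ℓ.B : ℝ) * ℓ'.C = ℓ'.B * ℓ.C

lemma Same.abs_form_div_le {ℓ ℓ' : RatLine s t} (h : Same ℓ ℓ') (v : ℝ × ℝ) :
    |ℓ.form v| / ℓ.M ≤ |ℓ'.form v| / ℓ'.M := by
  obtain ⟨h1, h2, h3⟩ := h
  have e1 : (ℓ'.A : ℝ) * ℓ.form v = ℓ.A * ℓ'.form v := by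
    unfold form; linear_combination (-v.2) * h1 - h2
  have e2 : (ℓ'.B : ℝ) * ℓ.form v = ℓ.B * ℓ'.form v := by
    unfold form; linear_combination v.1 * h1 - h3
  rw [div_le_div_iff₀ ℓ.M_pos ℓ'.M_pos]
  have e1' := congrArg abs e1
  have e2' := congrArg abs e2
  rw [abs_mul, abs_mul] at e1' e2'
  have a1 := mul_le_mul_of_nonneg_right ℓ.absA_le_M (abs_nonneg (ℓ'.form v))
  have a2 := mul_le_mul_of_nonneg_right ℓ.absB_le_M (abs_nonneg (ℓ'.form v))
  rcases max_choice |(ℓ'.A : ℝ)| |(ℓ'.B : ℝ)| with h | h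
  · rw [show ℓ'.M = |(ℓ'.A : ℝ)| from h]; linarith
  · rw [show ℓ'.M = |(ℓ'.B : ℝ)| from h]; linarith

end RatLine

/-! ### Pairs of rational lines -/

namespace RatLine

variable {s t : ℝ}

/-- A value of an integral form at a rational point of denominator `q` vanishes as soon as it is
smaller than `1 / q`. -/
lemma form_pt_eq_zero (ℓ ℓ' : RatLine s t)
    (h : |ℓ.form (ℓ'.pt.1, ℓ'.pt.2)| < 1 / ℓ'.q) : ℓ.form (ℓ'.pt.1, ℓ'.pt.2) = 0 := by
  obtain ⟨p, hp⟩ := exists_int_eq_mul_of_den_dvd ℓ'.pt.1 (ratDen ℓ'.pt) (Nat.dvd_lcm_left _ _)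
  obtain ⟨r, hr⟩ := exists_int_eq_mul_of_den_dvd ℓ'.pt.2 (ratDen ℓ'.pt) (Nat.dvd_lcm_right _ _)
  have hp' : ℓ'.q * (ℓ'.pt.1 : ℝ) = p := by
    unfold q; exact_mod_cast congrArg (fun x : ℚ => (x : ℝ)) hp
  have hr' : ℓ'.q * (ℓ'.pt.2 : ℝ) = r := by
    unfold q; exact_mod_cast congrArg (fun x : ℚ => (x : ℝ)) hr
  have hq := ℓ'.q_pos
  have e : ℓ'.q * ℓ.form (ℓ'.pt.1, ℓ'.pt.2)
      = ((ℓ.A * p + ℓ.B * r + ℓ.C * (ratDen ℓ'.pt : ℤ) : ℤ) : ℝ) := by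
    push_cast
    rw [← hp', ← hr']
    unfold form
    change _ = _ + (ℓ.C : ℝ) * ℓ'.q
    ring
  have h1 : |ℓ'.q * ℓ.form (ℓ'.pt.1, ℓ'.pt.2)| < 1 := by
    rw [abs_mul, abs_of_pos hq]
    rwa [lt_div_iff₀' hq] at h
  rw [e] at h1
  have h2 : ℓ.A * p + ℓ.B * r + ℓ.C * (ratDen ℓ'.pt : ℤ) = 0 :=
    Int.abs_lt_one_iff.mp (by exact_mod_cast h1)
  rw [h2, Int.cast_zero] at e
  exact (mul_eq_zero.mp e).resolve_left hq.ne'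

/-- Two lines which share two distinct points coincide. -/
lemma same_of_form_pt_eq_zero {ℓ ℓ' : RatLine s t} (hne : ℓ.pt ≠ ℓ'.pt)
    (h : ℓ.form (ℓ'.pt.1, ℓ'.pt.2) = 0) (h' : ℓ'.form (ℓ.pt.1, ℓ.pt.2) = 0) : Same ℓ ℓ' := by
  have h1 := ℓ.eq_zero_real
  have h2 := ℓ'.eq_zero_real
  unfold form at h h'
  simp only at h h'
  have hD : (ℓ.A : ℝ) * ℓ'.B = ℓ'.A * ℓ.B := by
    by_contra hD
    have hD' := sub_ne_zero.mpr hD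
    apply hne
    apply Prod.ext
    · have : ((ℓ.pt.1 : ℝ) - ℓ'.pt.1) = 0 := by
        apply (mul_eq_zero.mp (?_ : ((ℓ.A : ℝ) * ℓ'.B - ℓ'.A * ℓ.B) * _ = 0)).resolve_left hD'
        linear_combination ℓ'.B * (h1 - h) - ℓ.B * (h' - h2)
      exact_mod_cast sub_eq_zero.mp this
    · have : ((ℓ.pt.2 : ℝ) - ℓ'.pt.2) = 0 := by
        apply (mul_eq_zero.mp (?_ : ((ℓ.A : ℝ) * ℓ'.B - ℓ'.A * ℓ.B) * _ = 0)).resolve_left hD'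
        linear_combination ℓ.A * (h' - h2) - ℓ'.A * (h1 - h)
      exact_mod_cast sub_eq_zero.mp this
  refine ⟨hD, ?_, ?_⟩
  · linear_combination ℓ.A * h' - ℓ'.A * h1 - ℓ.pt.2 * hD
  · linear_combination ℓ.B * h' - ℓ'.B * h1 + ℓ.pt.1 * hD

/-- If two lines pass close to every point of a set `X` and their determinant is small enough, then
either they coincide or they intersect in a rational point of small denominator whose box contains
all of `X`. -/
lemma same_or_exists_pt (hs : 0 ≤ s) (ht : 0 ≤ t) (ℓ ℓ' : RatLine s t)
    {X : Set (ℝ × ℝ)} (hX : X.Nonempty) {E θ ε : ℝ}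
    (hE : |(ℓ.A : ℝ)| * ℓ'.M + |(ℓ'.A : ℝ)| * ℓ.M ≤ E)
    (h : ∀ v ∈ X, |ℓ.form v| ≤ ℓ.M * θ) (h' : ∀ v ∈ X, |ℓ'.form v| ≤ ℓ'.M * θ)
    (h1 : 2 * ℓ.M * ℓ'.M * θ < 1) (h2 : E * θ < 1) (h3 : 2 * ℓ.M * ℓ'.M * θ * E ^ s ≤ ε)
    (h4 : E ^ (1 + t) * θ ≤ ε) :
    Same ℓ ℓ' ∨ ∃ P : ℚ × ℚ, (ratDen P : ℝ) ≤ E ∧ ∀ v ∈ X,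
      |v.1 - P.1| ≤ ε / (ratDen P : ℝ) ^ (1 + s) ∧ |v.2 - P.2| ≤ ε / (ratDen P : ℝ) ^ (1 + t) := by
  have hM := ℓ.M_pos
  have hM' := ℓ'.M_pos
  have hθ : 0 ≤ θ := by
    obtain ⟨v, hv⟩ := hX
    have := (abs_nonneg _).trans (h v hv)
    exact nonneg_of_mul_nonneg_right this hM
  have eB : ∀ v ∈ X, |(ℓ'.B : ℝ) * ℓ.form v - ℓ.B * ℓ'.form v| ≤ 2 * ℓ.M * ℓ'.M * θ := by
    intro v hv
    calc _ ≤ |(ℓ'.B : ℝ)| * |ℓ.form v| + |(ℓ.B : ℝ)| * |ℓ'.form v| := by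
          rw [← abs_mul, ← abs_mul]; exact abs_sub _ _
      _ ≤ ℓ'.M * (ℓ.M * θ) + ℓ.M * (ℓ'.M * θ) := by
          have := ℓ.absB_le_M
          have := ℓ'.absB_le_M
          have := h v hv
          have := h' v hv
          gcongr
      _ = _ := by ring
  have eA : ∀ v ∈ X, |(ℓ.A : ℝ) * ℓ'.form v - ℓ'.A * ℓ.form v| ≤ E * θ := by
    intro v hv
    calc _ ≤ |(ℓ.A : ℝ)| * |ℓ'.form v| + |(ℓ'.A : ℝ)| * |ℓ.form v| := by
          rw [← abs_mul, ← abs_mul]; exact abs_sub _ _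
      _ ≤ |(ℓ.A : ℝ)| * (ℓ'.M * θ) + |(ℓ'.A : ℝ)| * (ℓ.M * θ) := by
          have := h v hv
          have := h' v hv
          gcongr
      _ = (|(ℓ.A : ℝ)| * ℓ'.M + |(ℓ'.A : ℝ)| * ℓ.M) * θ := by ring
      _ ≤ E * θ := by gcongr
  set D : ℤ := ℓ.A * ℓ'.B - ℓ'.A * ℓ.B with hD
  have int_zero : ∀ z : ℤ, |(z : ℝ)| < 1 → z = 0 := fun z hz =>
    Int.abs_lt_one_iff.mp (by exact_mod_cast hz)
  rcases eq_or_ne D 0 with h0 | h0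
  · left
    obtain ⟨v, hv⟩ := hX
    have h0' : (ℓ.A : ℝ) * ℓ'.B - ℓ'.A * ℓ.B = 0 := by exact_mod_cast h0
    refine ⟨by linarith, ?_, ?_⟩
    · have : ((ℓ.A * ℓ'.C - ℓ'.A * ℓ.C : ℤ) : ℝ) = ℓ.A * ℓ'.form v - ℓ'.A * ℓ.form v := by
        push_cast; unfold form; linear_combination (-v.2) * h0'
      have h5 := int_zero _ (by rw [this]; exact (eA v hv).trans_lt h2)
      have h6 : ((ℓ.A * ℓ'.C - ℓ'.A * ℓ.C : ℤ) : ℝ) = 0 := by rw [h5, Int.cast_zero]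
      push_cast at h6
      linarith
    · have : ((ℓ'.B * ℓ.C - ℓ.B * ℓ'.C : ℤ) : ℝ) = ℓ'.B * ℓ.form v - ℓ.B * ℓ'.form v := by
        push_cast; unfold form; linear_combination (-v.1) * h0'
      have h5 := int_zero _ (by rw [this]; exact (eB v hv).trans_lt h1)
      have h6 : ((ℓ'.B * ℓ.C - ℓ.B * ℓ'.C : ℤ) : ℝ) = 0 := by rw [h5, Int.cast_zero]
      push_cast at h6
      linarith
  · right
    have hDr : (D : ℝ) ≠ 0 := by exact_mod_cast h0
    have hDq : (D : ℚ) ≠ 0 := by exact_mod_cast h0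
    have hDcast : (D : ℝ) = ℓ.A * ℓ'.B - ℓ'.A * ℓ.B := by rw [hD]; push_cast; ring
    set x : ℚ := (ℓ.B * ℓ'.C - ℓ'.B * ℓ.C : ℤ) / D with hx
    set y : ℚ := (ℓ'.A * ℓ.C - ℓ.A * ℓ'.C : ℤ) / D with hy
    have hx' : (D : ℚ) * x = (ℓ.B * ℓ'.C - ℓ'.B * ℓ.C : ℤ) := by rw [hx]; field_simp
    have hy' : (D : ℚ) * y = (ℓ'.A * ℓ.C - ℓ.A * ℓ'.C : ℤ) := by rw [hy]; field_simp
    have hxr : (D : ℝ) * x = ℓ.B * ℓ'.C - ℓ'.B * ℓ.C := by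
      exact_mod_cast congrArg (fun x : ℚ => (x : ℝ)) hx'
    have hyr : (D : ℝ) * y = ℓ'.A * ℓ.C - ℓ.A * ℓ'.C := by
      exact_mod_cast congrArg (fun x : ℚ => (x : ℝ)) hy'
    have hden : (ratDen (x, y) : ℝ) ≤ |(D : ℝ)| := by
      have h5 := ratDen_le_of_mul_eq x y D _ _ h0 hx' hy'
      have h6 : (ratDen (x, y) : ℝ) ≤ (D.natAbs : ℝ) := by exact_mod_cast h5
      rwa [Nat.cast_natAbs, Int.cast_abs] at h6
    have hDE : |(D : ℝ)| ≤ E := by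
      refine le_trans ?_ hE
      rw [hDcast]
      calc _ ≤ |(ℓ.A : ℝ)| * |(ℓ'.B : ℝ)| + |(ℓ'.A : ℝ)| * |(ℓ.B : ℝ)| := by
            rw [← abs_mul, ← abs_mul]; exact abs_sub _ _
        _ ≤ _ := by
            have := ℓ.absB_le_M
            have := ℓ'.absB_le_M
            gcongr
    refine ⟨(x, y), hden.trans hDE, fun v hv => ?_⟩
    have hqpos : (0 : ℝ) < ratDen (x, y) := by exact_mod_cast ratDen_pos (x, y)
    have hDpos : 0 < |(D : ℝ)| := abs_pos.mpr hDr
    have hEpos : 0 < E := hDpos.trans_le hDE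
    -- Both coordinates are obtained from Cramer's rule, with one factor of `D` cancelling one
    -- factor of the denominator.
    have cramer : ∀ (z u b : ℝ), 0 ≤ u → 0 ≤ b → |(D : ℝ) * z| ≤ b → b * E ^ u ≤ ε →
        |z| ≤ ε / (ratDen (x, y) : ℝ) ^ (1 + u) := by
      intro z u b hu hb hz hbE
      rw [abs_mul] at hz
      rw [le_div_iff₀ (Real.rpow_pos_of_pos hqpos _), Real.rpow_add hqpos, Real.rpow_one]
      calc |z| * (ratDen (x, y) * (ratDen (x, y) : ℝ) ^ u)
          ≤ |z| * (|(D : ℝ)| * E ^ u) := by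
            have := Real.rpow_le_rpow hqpos.le (hden.trans hDE) hu
            gcongr
        _ = |(D : ℝ)| * |z| * E ^ u := by ring
        _ ≤ b * E ^ u := by gcongr
        _ ≤ ε := hbE
    constructor
    · refine cramer _ s _ hs (by positivity) ?_ h3
      have e : (D : ℝ) * (v.1 - x) = ℓ'.B * ℓ.form v - ℓ.B * ℓ'.form v := by
        rw [mul_sub, hxr, hDcast]; unfold form; ring
      rw [e]; exact eB v hv
    · refine cramer _ t (E * θ) ht (by positivity) ?_ ?_
      · have e : (D : ℝ) * (v.2 - y) = ℓ.A * ℓ'.form v - ℓ'.A * ℓ.form v := by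
          rw [mul_sub, hyr, hDcast]; unfold form; ring
        rw [e]; exact eA v hv
      · rw [Real.rpow_add hEpos, Real.rpow_one] at h4
        linarith

end RatLine

/-! ### Classes of rational points -/

lemma le_pow_mul_of_rpow_le_mul_rpow {a b c p : ℝ} (e : ℕ) (ha : 0 ≤ a) (hb : 0 ≤ b) (hc : 1 ≤ c)
    (hp : 0 < p) (hep : 1 ≤ e * p) (h : a ^ p ≤ c * b ^ p) : a ≤ c ^ e * b := by
  have hc0 : 0 ≤ c := by linarith
  rw [← Real.rpow_le_rpow_iff ha (by positivity) hp, Real.mul_rpow (by positivity) hb]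
  refine h.trans (mul_le_mul_of_nonneg_right ?_ (Real.rpow_nonneg hb _))
  rw [← Real.rpow_natCast, ← Real.rpow_mul hc0]
  simpa using Real.rpow_le_rpow_of_exponent_le hc hep

lemma exists_nat_mul_pow_le_lt {R a x : ℝ} (hR : 1 < R) (ha : 0 < a) (hx : a ≤ x) :
    ∃ n : ℕ, a * R ^ n ≤ x ∧ x < a * R ^ (n + 1) := by
  obtain ⟨n, h1, h2⟩ := exists_nat_pow_near (x := x / a) (y := R) (by rwa [one_le_div ha]) hR
  refine ⟨n, ?_, ?_⟩
  · rwa [le_div_iff₀' ha] at h1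
  · rwa [div_lt_iff₀' ha] at h2

namespace RatLine

variable {s t : ℝ}

/-- The class `(n, k)` of rational points: those whose strip has width of the order of
`R ^ (-(n + k + 1))` and which are treated at the scale `R ^ (-n)`. The scale is determined by the
size of `g ^ (1 + t)`, except that it is kept strictly coarser than the width. -/
def InClass (R κ ε : ℝ) (n k : ℕ) (ℓ : RatLine s t) : Prop :=
  2 * ε * R ^ (n + k + 1) ≤ ℓ.H ∧ ℓ.H < 2 * ε * R ^ (n + k + 2) ∧
    ε * R ^ n ≤ κ * ℓ.g ^ (1 + t) ∧ (k = 0 ∨ κ * ℓ.g ^ (1 + t) < ε * R ^ (n + 1))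

lemma exists_inClass (hs : 0 ≤ s) (ht : 0 ≤ t) {R κ ε : ℝ} (hR : 1 < R) (hκ : 1 ≤ κ) (hε : 0 < ε)
    (hεR : 2 * ε * R ≤ 1) (ℓ : RatLine s t) : ∃ n k, InClass R κ ε n k ℓ := by
  have hG : 1 ≤ κ * ℓ.g ^ (1 + t) :=
    one_le_mul_of_one_le_of_one_le hκ (Real.one_le_rpow (ℓ.one_le_g hs) (by linarith))
  have hε1 : ε ≤ 1 := by nlinarith
  obtain ⟨m, h1, h2⟩ := exists_nat_mul_pow_le_lt (a := 2 * ε * R) hR (by positivity)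
    (hεR.trans ℓ.one_le_H)
  obtain ⟨n, h3, h4⟩ := exists_nat_mul_pow_le_lt hR hε (hε1.trans hG)
  have e1 : 2 * ε * R ^ (m + 1) ≤ ℓ.H := by rw [pow_succ']; linarith
  have e2 : ℓ.H < 2 * ε * R ^ (m + 2) := by
    rw [pow_succ' R (m + 1)]; linarith
  rcases le_or_gt n m with h | h
  · obtain ⟨k, rfl⟩ := Nat.exists_eq_add_of_le h
    exact ⟨n, k, e1, e2, h3, Or.inr h4⟩
  · refine ⟨m, 0, e1, e2, le_trans ?_ h3, Or.inl rfl⟩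
    have := pow_le_pow_right₀ hR.le h.le
    gcongr

lemma InClass.H_le {R κ ε : ℝ} {n k : ℕ} {ℓ ℓ' : RatLine s t}
    (hR : 0 ≤ R) (h : InClass R κ ε n k ℓ) (h' : InClass R κ ε n k ℓ') : ℓ.H ≤ R * ℓ'.H :=
  calc ℓ.H ≤ 2 * ε * R ^ (n + k + 2) := h.2.1.le
    _ = R * (2 * ε * R ^ (n + k + 1)) := by ring
    _ ≤ R * ℓ'.H := mul_le_mul_of_nonneg_left h'.1 hR

lemma q_rpow_le (hs : 0 ≤ s) (hst : s + t = 1) {R c : ℝ} (hR : 0 ≤ R)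
    (ℓ ℓ' : RatLine s t) (hH : ℓ.H ≤ R * ℓ'.H) (hg : ℓ'.g ≤ c * ℓ.g) :
    ℓ.q ^ t ≤ R * c * ℓ'.q ^ t := by
  rw [← ℓ.q_rpow_mul_g hst, ← ℓ'.q_rpow_mul_g hst] at hH
  have hgp := ℓ.g_pos hs
  refine le_of_mul_le_mul_right ?_ hgp
  have hq := Real.rpow_nonneg ℓ'.q_pos.le t
  calc _ ≤ R * (ℓ'.q ^ t * ℓ'.g) := hH
    _ ≤ R * (ℓ'.q ^ t * (c * ℓ.g)) := by gcongr
    _ = _ := by ring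

/-- In the classes `(n, 0)`, denominators are comparable. -/
lemma InClass.q_le_of_zero (hs : 0 ≤ s) (hst : s + t = 1) (hle : s ≤ t) {R κ ε : ℝ} (hR : 1 ≤ R)
    (hκ : 1 ≤ κ) {n : ℕ} {ℓ ℓ' : RatLine s t}
    (h : InClass R κ ε n 0 ℓ) (h' : InClass R κ ε n 0 ℓ') :
    ℓ.q ≤ (2 * R ^ 3 * κ) ^ 2 * ℓ'.q := by
  have hg : ℓ'.g ≤ (2 * R ^ 2 * κ) * ℓ.g := by
    have hc : 1 ≤ 2 * R ^ 2 * κ := by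
      have : 1 ≤ R ^ 2 := one_le_pow₀ hR
      nlinarith
    rw [← pow_one (2 * R ^ 2 * κ)]
    refine le_pow_mul_of_rpow_le_mul_rpow (p := 1 + t) 1 (ℓ'.g_pos hs).le (ℓ.g_pos hs).le hc
      (by linarith) (by norm_num; linarith) ?_
    calc ℓ'.g ^ (1 + t) ≤ ℓ'.H := ℓ'.g_rpow_le_H hs hst hle
      _ ≤ 2 * ε * R ^ (n + 0 + 2) := h'.2.1.le
      _ = 2 * R ^ 2 * (ε * R ^ n) := by ring
      _ ≤ 2 * R ^ 2 * (κ * ℓ.g ^ (1 + t)) := by have := h.2.2.1; gcongr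
      _ = _ := by ring
  have hq := q_rpow_le hs hst (by linarith) ℓ ℓ' (h.H_le (by linarith) h') hg
  have hc : 1 ≤ 2 * R ^ 3 * κ := by
    have : 1 ≤ R ^ 3 := one_le_pow₀ hR
    nlinarith
  refine le_pow_mul_of_rpow_le_mul_rpow (p := t) 2 ℓ.q_pos.le ℓ'.q_pos.le hc
    (by linarith) (by norm_num; linarith) ?_
  calc _ ≤ _ := hq
    _ = _ := by ring

/-- Invariants of two points of the same class with `g ^ (1 + t)` in the range of the class. -/
lemma InClass.bounds (hs : 0 ≤ s) (hst : s + t = 1) (hle : s ≤ t) {R κ ε : ℝ} (hR : 1 ≤ R)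
    (hκ : 0 < κ) {n k : ℕ} {ℓ ℓ' : RatLine s t}
    (h : InClass R κ ε n k ℓ) (h' : InClass R κ ε n k ℓ')
    (hG : κ * ℓ.g ^ (1 + t) < ε * R ^ (n + 1)) (hG' : κ * ℓ'.g ^ (1 + t) < ε * R ^ (n + 1)) :
    ℓ.M ≤ R ^ 5 * ℓ'.M ∧
      |(ℓ.A : ℝ)| * ℓ'.M + |(ℓ'.A : ℝ)| * ℓ.M ≤ 2 * R ^ 5 * ℓ'.g := by
  have hR0 : 0 ≤ R := by linarith
  have key : ∀ ℓ₁ ℓ₂ : RatLine s t, InClass R κ ε n k ℓ₁ → InClass R κ ε n k ℓ₂ →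
      κ * ℓ₁.g ^ (1 + t) < ε * R ^ (n + 1) → ℓ₁.g ≤ R * ℓ₂.g := by
    intro ℓ₁ ℓ₂ h₁ h₂ h₃
    rw [← pow_one R]
    refine le_pow_mul_of_rpow_le_mul_rpow (p := 1 + t) 1 (ℓ₁.g_pos hs).le (ℓ₂.g_pos hs).le hR
      (by linarith) (by norm_num; linarith) ?_
    refine le_of_mul_le_mul_left ?_ hκ
    calc κ * ℓ₁.g ^ (1 + t) ≤ R * (ε * R ^ n) := by rw [pow_succ] at h₃; linarith
      _ ≤ R * (κ * ℓ₂.g ^ (1 + t)) := by have := h₂.2.2.1; gcongr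
      _ = _ := by ring
  have qle : ∀ ℓ₁ ℓ₂ : RatLine s t, InClass R κ ε n k ℓ₁ → InClass R κ ε n k ℓ₂ →
      κ * ℓ₂.g ^ (1 + t) < ε * R ^ (n + 1) → ℓ₁.q ≤ R ^ 4 * ℓ₂.q := by
    intro ℓ₁ ℓ₂ h₁ h₂ h₃
    have hq := q_rpow_le hs hst hR0 ℓ₁ ℓ₂ (h₁.H_le hR0 h₂) (key ℓ₂ ℓ₁ h₂ h₁ h₃)
    have := le_pow_mul_of_rpow_le_mul_rpow (p := t) 2 ℓ₁.q_pos.le ℓ₂.q_pos.le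
      (one_le_mul_of_one_le_of_one_le hR hR) (by linarith) (by norm_num; linarith) hq
    calc _ ≤ _ := this
      _ = _ := by ring
  have hq := ℓ.q_pos
  have hq' := ℓ'.q_pos
  have hM := ℓ.M_pos
  have hM' := ℓ'.M_pos
  have h1 := qle ℓ ℓ' h h' hG'
  have h2 := qle ℓ' ℓ h' h hG
  have hMM : ℓ.M ≤ R ^ 5 * ℓ'.M := by
    refine le_of_mul_le_mul_left ?_ hq
    calc ℓ.q * ℓ.M ≤ R * (ℓ'.q * ℓ'.M) := h.H_le hR0 h'
      _ ≤ R * (R ^ 4 * ℓ.q * ℓ'.M) := by gcongr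
      _ = _ := by ring
  refine ⟨hMM, ?_⟩
  have hqs : ℓ.q ^ s ≤ R ^ 5 * ℓ'.q ^ s := by
    calc ℓ.q ^ s ≤ (R ^ 4 * ℓ'.q) ^ s := Real.rpow_le_rpow hq.le h1 hs
      _ = (R ^ 4) ^ s * ℓ'.q ^ s := Real.mul_rpow (by positivity) hq'.le
      _ ≤ R ^ 5 * ℓ'.q ^ s := by
        refine mul_le_mul_of_nonneg_right ?_ (Real.rpow_nonneg hq'.le _)
        calc (R ^ 4) ^ s ≤ (R ^ 4) ^ (1 : ℝ) :=
              Real.rpow_le_rpow_of_exponent_le (one_le_pow₀ hR) (by linarith)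
          _ = R ^ 4 := Real.rpow_one _
          _ ≤ R ^ 5 := pow_le_pow_right₀ hR (by norm_num)
  have hqs' := Real.rpow_nonneg hq'.le s
  calc _ ≤ R ^ 5 * ℓ'.q ^ s * ℓ'.M + ℓ'.q ^ s * (R ^ 5 * ℓ'.M) := by
        have := ℓ.absA_le_q.trans hqs
        have := ℓ'.absA_le_q
        gcongr
    _ = 2 * R ^ 5 * ℓ'.g := by unfold g; ring

/-- A line whose box meets a set of diameter of the order of `R ^ (-n)` is close to all of it. -/
lemma InClass.abs_form_le (hs : 0 ≤ s) (ht : 0 ≤ t) (hst : s + t = 1) {R κ ε ρ : ℝ} (hR : 1 ≤ R)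
    (hε : 0 ≤ ε) (hρ : 1 ≤ ρ) {n k : ℕ} {ℓ : RatLine s t} (h : InClass R κ ε n k ℓ)
    {u v : ℝ × ℝ} (hu : u ∈ ℓ.box ε) (h1 : |v.1 - u.1| ≤ ρ * (R ^ n)⁻¹)
    (h2 : |v.2 - u.2| ≤ ρ * (R ^ n)⁻¹) : |ℓ.form v| ≤ ℓ.M * (3 * ρ * (R ^ n)⁻¹) := by
  have hRn : 0 < R ^ n := by positivity
  have a1 : |ℓ.form u| ≤ ℓ.M * (ρ * (R ^ n)⁻¹) := by
    refine (ℓ.abs_form_le_of_mem_box hε hs ht hst hu).trans ?_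
    rw [div_le_iff₀ ℓ.q_pos]
    have a2 : 2 * ε * R ^ n ≤ ℓ.H := by
      refine le_trans ?_ h.1
      have := pow_le_pow_right₀ hR (show n ≤ n + k + 1 by omega)
      gcongr
    have a3 : 2 * ε ≤ ℓ.H * (R ^ n)⁻¹ := by rwa [← div_eq_mul_inv, le_div_iff₀ hRn]
    have a4 : 0 ≤ ℓ.H * (R ^ n)⁻¹ := mul_nonneg ℓ.H_pos.le (by positivity)
    calc 2 * ε ≤ ℓ.H * (R ^ n)⁻¹ := a3
      _ ≤ ρ * (ℓ.H * (R ^ n)⁻¹) := le_mul_of_one_le_left a4 hρ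
      _ = _ := by unfold H; ring
  have a5 := ℓ.abs_form_sub_le v u _ h1 h2
  have a6 := abs_sub_abs_le_abs_sub (ℓ.form v) (ℓ.form u)
  linarith

/-- All lines of a class `(n, 0)` which are relevant for a set of diameter of the order of `R ^ (-n)`
and belong to distinct points coincide: each passes through the points of the others. -/
lemma InClass.same_of_zero (hs : 0 ≤ s) (ht : 0 ≤ t) (hst : s + t = 1) (hle : s ≤ t)
    {R κ ε ρ : ℝ} (hR : 1 ≤ R) (hκ : 1 ≤ κ) (hε : 0 ≤ ε) (hρ : 1 ≤ ρ)
    (hsmall : (6 * ρ * R ^ 2 + 2) * (2 * R ^ 3 * κ) ^ 2 * ε < 1) {n : ℕ} {ℓ ℓ' : RatLine s t}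
    (hne : ℓ.pt ≠ ℓ'.pt) (h : InClass R κ ε n 0 ℓ) (h' : InClass R κ ε n 0 ℓ')
    {u v : ℝ × ℝ} (hu : u ∈ ℓ.box ε) (hv : v ∈ ℓ'.box ε)
    (h1 : |v.1 - u.1| ≤ ρ * (R ^ n)⁻¹) (h2 : |v.2 - u.2| ≤ ρ * (R ^ n)⁻¹) : Same ℓ ℓ' := by
  have key : ∀ ℓ₁ ℓ₂ : RatLine s t, InClass R κ ε n 0 ℓ₁ → InClass R κ ε n 0 ℓ₂ →
      ∀ u v : ℝ × ℝ, u ∈ ℓ₁.box ε → v ∈ ℓ₂.box ε → |v.1 - u.1| ≤ ρ * (R ^ n)⁻¹ →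
      |v.2 - u.2| ≤ ρ * (R ^ n)⁻¹ → ℓ₁.form (ℓ₂.pt.1, ℓ₂.pt.2) = 0 := by
    intro ℓ₁ ℓ₂ h₁ h₂ u v hu hv h3 h4
    apply form_pt_eq_zero
    set Λ := (2 * R ^ 3 * κ) ^ 2 with hΛ
    have hΛ1 : 1 ≤ Λ := by
      apply one_le_pow₀
      have : 1 ≤ R ^ 3 := one_le_pow₀ hR
      nlinarith
    have a1 := h₁.abs_form_le hs ht hst hR hε hρ hu h3 h4
    have a2 := h₁.q_le_of_zero hs hst hle hR hκ h₂
    have a3 := ℓ₁.abs_form_sub_pt_le ℓ₂ hε hs ht (by linarith) (by linarith) hΛ1 a2 hv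
    have hq₁ := ℓ₁.q_pos
    have hq₂ := ℓ₂.q_pos
    have a4 : ℓ₁.M * (3 * ρ * (R ^ n)⁻¹) ≤ 6 * ρ * R ^ 2 * Λ * ε / ℓ₂.q := by
      rw [le_div_iff₀ hq₂]
      have a5 : ℓ₂.q ≤ Λ * ℓ₁.q := h₂.q_le_of_zero hs hst hle hR hκ h₁
      have hM := ℓ₁.M_pos
      have hRn : 0 < R ^ n := by positivity
      calc ℓ₁.M * (3 * ρ * (R ^ n)⁻¹) * ℓ₂.q ≤ ℓ₁.M * (3 * ρ * (R ^ n)⁻¹) * (Λ * ℓ₁.q) := by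
            gcongr
        _ = ℓ₁.H * (3 * ρ * (R ^ n)⁻¹ * Λ) := by unfold H; ring
        _ ≤ (2 * ε * R ^ (n + 0 + 2)) * (3 * ρ * (R ^ n)⁻¹ * Λ) := by
            have := h₁.2.1.le
            gcongr
        _ = 6 * ρ * R ^ 2 * Λ * ε := by
            rw [add_zero, pow_add]; field_simp; ring
    have a6 := abs_sub_abs_le_abs_sub (ℓ₁.form (ℓ₂.pt.1, ℓ₂.pt.2)) (ℓ₁.form v)
    rw [abs_sub_comm (ℓ₁.form v)] at a3
    calc _ ≤ 6 * ρ * R ^ 2 * Λ * ε / ℓ₂.q + 2 * Λ * ε / ℓ₂.q := by linarith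
      _ = ((6 * ρ * R ^ 2 + 2) * Λ * ε) / ℓ₂.q := by ring
      _ < 1 / ℓ₂.q := by gcongr
  refine same_of_form_pt_eq_zero hne (key ℓ ℓ' h h' u v hu hv h1 h2)
    (key ℓ' ℓ h' h v u hv hu ?_ ?_)
  · rwa [abs_sub_comm]
  · rwa [abs_sub_comm]

/-- The lines of a class which are relevant for a set `X` of diameter of the order of `R ^ (-n)`
coincide, unless `X` is contained in the box of a rational point of smaller height. -/
lemma InClass.same_or_exists_pt (hs : 0 ≤ s) (ht : 0 ≤ t) (hst : s + t = 1) (hle : s ≤ t)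
    {R ε ρ : ℝ} (hR : 1 ≤ R) (hε : 0 ≤ ε) (hε1 : ε ≤ 1) (hρ : 1 ≤ ρ) {n k : ℕ}
    {ℓ ℓ' : RatLine s t} (h : InClass R (12 * ρ * R ^ 11) ε n k ℓ)
    (h' : InClass R (12 * ρ * R ^ 11) ε n k ℓ')
    (hG : 12 * ρ * R ^ 11 * ℓ.g ^ (1 + t) < ε * R ^ (n + 1))
    (hG' : 12 * ρ * R ^ 11 * ℓ'.g ^ (1 + t) < ε * R ^ (n + 1))
    {X : Set (ℝ × ℝ)} (hX : ∀ x ∈ X, ∀ y ∈ X,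
      |x.1 - y.1| ≤ ρ * (R ^ n)⁻¹ ∧ |x.2 - y.2| ≤ ρ * (R ^ n)⁻¹)
    {u v : ℝ × ℝ} (hu : u ∈ ℓ.box ε) (hv : v ∈ ℓ'.box ε) (huX : u ∈ X) (hvX : v ∈ X) :
    Same ℓ ℓ' ∨ ∃ P : ℚ × ℚ, (∀ ℓ₀ : RatLine s t, ℓ₀.pt = P → X ⊆ ℓ₀.box ε ∧
      ℓ₀.H < 2 * ε * R ^ (n + 1)) := by
  obtain ⟨hM, hE⟩ := h.bounds hs hst hle hR (by positivity) h' hG hG'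
  set θ := 3 * ρ * (R ^ n)⁻¹ with hθ
  have hR0 : 0 < R := by linarith
  have hRn : 0 < R ^ n := by positivity
  have hθ0 : 0 ≤ θ := by positivity
  set G := ℓ'.g ^ (1 + t) with hGdef
  have hg := ℓ'.g_pos hs
  have hg1 := ℓ'.one_le_g hs
  have hG1 : 0 ≤ G := by positivity
  -- All error terms are bounded by this quantity; it explains the constant `12 ρ R ^ 11`.
  have hY : 4 * R ^ 10 * G * θ < ε := by
    have : 4 * R ^ 10 * G * θ = (12 * ρ * R ^ 11 * G) / R ^ (n + 1) := by
      rw [hθ, pow_succ]; field_simp; ring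
    rw [this, div_lt_iff₀ (by positivity)]
    exact hG'
  have hM' := ℓ'.M_pos
  have hM0 := ℓ.M_pos
  have hR5 : 1 ≤ R ^ 5 := one_le_pow₀ hR
  have hc : 1 ≤ 2 * R ^ 5 := by linarith
  have b1 : ∀ x : ℝ, 0 ≤ x → x ≤ 1 → (2 * R ^ 5 * ℓ'.g) ^ x ≤ 2 * R ^ 5 * ℓ'.g ^ x := by
    intro x hx hx1
    rw [Real.mul_rpow (by positivity) hg.le]
    refine mul_le_mul_of_nonneg_right ?_ (by positivity)
    simpa using Real.rpow_le_rpow_of_exponent_le hc hx1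
  have b2 : 2 * ℓ.M * ℓ'.M * θ * (2 * R ^ 5 * ℓ'.g) ^ s ≤ 4 * R ^ 10 * G * θ :=
    calc _ ≤ 2 * (R ^ 5 * ℓ'.M) * ℓ'.M * θ * (2 * R ^ 5 * ℓ'.g ^ s) := by
          have := b1 s hs (by linarith)
          gcongr
      _ = 4 * R ^ 10 * (ℓ'.M * ℓ'.M * ℓ'.g ^ s) * θ := by ring
      _ ≤ _ := by
          have := ℓ'.M_sq_mul_g_rpow_le hs hst hle
          gcongr
  have b3 : 2 * ℓ.M * ℓ'.M * θ ≤ 4 * R ^ 10 * G * θ := by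
    refine le_trans (le_mul_of_one_le_right (by positivity) ?_) b2
    refine Real.one_le_rpow ?_ hs
    nlinarith
  have b4 : (2 * R ^ 5 * ℓ'.g) ^ (1 + t) ≤ 4 * R ^ 10 * G := by
    rw [Real.rpow_add (by positivity), Real.rpow_one]
    calc _ ≤ 2 * R ^ 5 * ℓ'.g * (2 * R ^ 5 * ℓ'.g ^ t) := by
          have := b1 t ht (by linarith)
          gcongr
      _ = 4 * R ^ 10 * (ℓ'.g * ℓ'.g ^ t) := by ring
      _ = _ := by rw [hGdef, Real.rpow_add hg, Real.rpow_one]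
  have b5 : 2 * R ^ 5 * ℓ'.g ≤ (2 * R ^ 5 * ℓ'.g) ^ (1 + t) := by
    simpa using Real.rpow_le_rpow_of_exponent_le (x := 2 * R ^ 5 * ℓ'.g) (y := 1) (z := 1 + t)
      (by nlinarith) (by linarith)
  have c4 : (2 * R ^ 5 * ℓ'.g) ^ (1 + t) * θ ≤ ε :=
    (mul_le_mul_of_nonneg_right b4 hθ0).trans hY.le
  have c2 : 2 * R ^ 5 * ℓ'.g * θ < 1 :=
    ((mul_le_mul_of_nonneg_right (b5.trans b4) hθ0).trans_lt hY).trans_le hε1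
  rcases RatLine.same_or_exists_pt hs ht ℓ ℓ' ⟨u, huX⟩ hE
    (fun w hw => h.abs_form_le hs ht hst hR hε hρ hu (hX w hw u huX).1 (hX w hw u huX).2)
    (fun w hw => h'.abs_form_le hs ht hst hR hε hρ hv (hX w hw v hvX).1 (hX w hw v hvX).2)
    ((b3.trans_lt hY).trans_le hε1) c2 (b2.trans hY.le) c4 with h0 | ⟨P, hP, hPX⟩
  · exact Or.inl h0
  · refine Or.inr ⟨P, fun ℓ₀ hℓ₀ => ⟨?_, ?_⟩⟩
    · subst hℓ₀
      exact hPX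
    · subst hℓ₀
      have d1 : ℓ₀.H ≤ 4 * R ^ 10 * G := by
        refine le_trans ?_ b4
        refine le_trans ?_ (Real.rpow_le_rpow ℓ₀.q_pos.le hP (by linarith))
        rw [Real.rpow_add ℓ₀.q_pos, Real.rpow_one]
        exact mul_le_mul_of_nonneg_left (ℓ₀.M_le hle) ℓ₀.q_pos.le
      have d2 : 4 * R ^ 10 * G ≤ 12 * ρ * R ^ 11 * G := by
        have : R ^ 10 ≤ R ^ 11 := pow_le_pow_right₀ hR (by norm_num)
        have : 4 * R ^ 10 ≤ 12 * ρ * R ^ 11 :=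
          calc 4 * R ^ 10 ≤ 12 * R ^ 11 := by nlinarith
            _ ≤ 12 * ρ * R ^ 11 :=
              mul_le_mul_of_nonneg_right (by linarith) (by positivity)
        gcongr
      have d3 : 0 ≤ ε * R ^ (n + 1) := by positivity
      linarith

/-- The set of points approximated too well by a rational point of class `(n, k)`. -/
def danger (L : ℚ × ℚ → RatLine s t) (R κ ε : ℝ) (n k : ℕ) : Set (ℝ × ℝ) :=
  {v | ∃ P, InClass R κ ε n k (L P) ∧ v ∈ (L P).box ε}

/-- A set of diameter of the order of `R ^ (-n)` which avoids the dangerous sets of width at least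
`R ^ (-n)` meets each class `(n, k)` within a single strip. -/
theorem exists_strip (hs : 0 ≤ s) (ht : 0 ≤ t) (hst : s + t = 1) (hle : s ≤ t)
    {R ε ρ : ℝ} (hR : 1 < R) (hε : 0 < ε) (hρ : 1 ≤ ρ)
    (hsmall : (6 * ρ * R ^ 2 + 2) * (2 * R ^ 3 * (12 * ρ * R ^ 11)) ^ 2 * ε < 1)
    (hεR : 2 * ε * R ≤ 1)
    (L : ℚ × ℚ → RatLine s t) (hL : ∀ P, (L P).pt = P) (n k : ℕ) {X : Set (ℝ × ℝ)}
    (hX : ∀ x ∈ X, ∀ y ∈ X, |x.1 - y.1| ≤ ρ * (R ^ n)⁻¹ ∧ |x.2 - y.2| ≤ ρ * (R ^ n)⁻¹)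
    (hfree : ∀ n' k', n' + k' + 1 ≤ n →
      ∀ x ∈ X, x ∉ danger L R (12 * ρ * R ^ 11) ε n' k') :
    ∃ a b c : ℝ, max |a| |b| = 1 ∧ ∀ x ∈ X, x ∈ danger L R (12 * ρ * R ^ 11) ε n k →
      |a * x.1 + b * x.2 + c| ≤ (R ^ (n + k + 1))⁻¹ := by
  set κ := 12 * ρ * R ^ 11 with hκ
  have hκ1 : 1 ≤ κ := by
    have : 1 ≤ R ^ 11 := one_le_pow₀ hR.le
    nlinarith
  by_cases hne : ∃ u ∈ X, u ∈ danger L R κ ε n k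
  swap
  · exact ⟨1, 0, 0, by simp, fun x hx hx' => (hne ⟨x, hx, hx'⟩).elim⟩
  obtain ⟨u, huX, P, hP, hu⟩ := hne
  set ℓ := L P with hℓ
  have hM := ℓ.M_pos
  refine ⟨ℓ.A / ℓ.M, ℓ.B / ℓ.M, ℓ.C / ℓ.M, ?_, ?_⟩
  · rw [abs_div, abs_div, abs_of_pos hM, max_div_div_right hM.le]
    exact div_self hM.ne'
  rintro v hvX ⟨P', hP', hv⟩
  have e : ℓ.A / ℓ.M * v.1 + ℓ.B / ℓ.M * v.2 + ℓ.C / ℓ.M = ℓ.form v / ℓ.M := by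
    unfold form; ring
  rw [e, abs_div, abs_of_pos hM]
  set ℓ' := L P' with hℓ'
  -- A single line suffices, as each box lies in the strip around its own line.
  suffices hsame : Same ℓ ℓ' by
    refine (hsame.abs_form_div_le v).trans ?_
    have h1 := ℓ'.abs_form_le_of_mem_box hε.le hs ht hst hv
    have hq' := ℓ'.q_pos
    have hM' := ℓ'.M_pos
    calc |ℓ'.form v| / ℓ'.M ≤ 2 * ε / ℓ'.q / ℓ'.M := by gcongr
      _ = 2 * ε / ℓ'.H := by rw [div_div]; rfl
      _ ≤ 2 * ε / (2 * ε * R ^ (n + k + 1)) :=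
          div_le_div_of_nonneg_left (by positivity) (by positivity) hP'.1
      _ = _ := by field_simp
  by_cases hPP : P = P'
  · subst hPP
    exact ⟨rfl, rfl, rfl⟩
  have hne : ℓ.pt ≠ ℓ'.pt := by rwa [hℓ, hℓ', hL, hL]
  rcases Nat.eq_zero_or_pos k with rfl | hk
  · exact hP.same_of_zero hs ht hst hle hR.le hκ1 hε.le hρ hsmall hne hP' hu hv
      (hX v hvX u huX).1 (hX v hvX u huX).2
  have hε1 : ε ≤ 1 := by nlinarith
  rcases hP.same_or_exists_pt hs ht hst hle hR.le hε.le hε1 hρ hP'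
    (hP.2.2.2.resolve_left hk.ne') (hP'.2.2.2.resolve_left hk.ne') hX hu hv huX hvX with
    h0 | ⟨P₀, hP₀⟩
  · exact h0
  -- The box of the intersection point contains `X`, and its height forces it into a class that `X`
  -- avoids.
  exfalso
  obtain ⟨h1, h2⟩ := hP₀ (L P₀) (hL P₀)
  obtain ⟨n', k', hc⟩ := (L P₀).exists_inClass hs ht hR hκ1 hε hεR
  have h3 := hc.1.trans_lt h2
  have h4 : n' + k' + 1 < n + 1 := by
    rw [mul_lt_mul_iff_right₀ (by positivity)] at h3
    exact (pow_lt_pow_iff_right₀ hR).mp h3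
  exact hfree n' k' (by omega) u huX ⟨P₀, hc, h1 huX⟩

end RatLine

/-! ### The strip property -/

/-- A set of the plane has the strip property if its complement is covered by sets `D n k` such
that every set `X` of diameter of the order of `R ^ (-n)` which avoids all `D n' k'` with
`n' + k' + 1 ≤ n` meets each `D n k` within a strip of width of the order of `R ^ (-(n + k + 1))`. -/
def StripProperty (S : Set (EuclideanSpace ℝ (Fin 2))) : Prop :=
  ∀ R ρ : ℝ, 1 < R → 1 ≤ ρ → ∃ D : ℕ → ℕ → Set (EuclideanSpace ℝ (Fin 2)),
    (∀ v, (∀ n k, v ∉ D n k) → v ∈ S) ∧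
    ∀ (n k : ℕ) (X : Set (EuclideanSpace ℝ (Fin 2))),
      (∀ x ∈ X, ∀ y ∈ X, ∀ i, |x i - y i| ≤ ρ * (R ^ n)⁻¹) →
      (∀ n' k', n' + k' + 1 ≤ n → ∀ x ∈ X, x ∉ D n' k') →
      ∃ a b c : ℝ, max |a| |b| = 1 ∧
        ∀ x ∈ X, x ∈ D n k → |a * x 0 + b * x 1 + c| ≤ (R ^ (n + k + 1))⁻¹

lemma ratDen_div_le (p r : ℤ) (q : ℕ) (hq : 0 < q) :
    ratDen ((p : ℚ) / q, (r : ℚ) / q) ≤ q := by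
  have hq0 : (q : ℚ) ≠ 0 := by exact_mod_cast hq.ne'
  have := ratDen_le_of_mul_eq ((p : ℚ) / q) ((r : ℚ) / q) q p r (by exact_mod_cast hq.ne')
    (by push_cast; field_simp) (by push_cast; field_simp)
  simpa using this

/-- A point outside all boxes of a fixed `ε` is badly approximable. -/
lemma mem_Bad_of_forall_notMem_box {s t ε : ℝ} (hs : 0 ≤ s) (ht : 0 ≤ t) (hε : 0 < ε)
    (L : ℚ × ℚ → RatLine s t) (hL : ∀ P, (L P).pt = P) (v : EuclideanSpace ℝ (Fin 2))
    (h : ∀ P, (v 0, v 1) ∉ (L P).box ε) : v ∈ Bad s t := by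
  rw [Bad, Set.mem_ofPred_eq]
  refine hε.trans_le (le_ciInf fun q => ?_)
  have hq : 0 < (q : ℕ) := q.pos
  have hqr : (0 : ℝ) < (q : ℕ) := by exact_mod_cast hq
  set Q : ℝ := ((q : ℕ) : ℝ) with hQ
  set p := round (Q * v 0) with hp
  set r := round (Q * v 1) with hr
  set P : ℚ × ℚ := ((p : ℚ) / (q : ℕ), (r : ℚ) / (q : ℕ)) with hP
  by_contra! hlt
  obtain ⟨h1, h2⟩ := max_lt_iff.mp hlt
  refine h P ?_
  have hden : (L P).q ≤ Q := by
    unfold RatLine.q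
    rw [hL, hQ]
    exact Nat.cast_le.mpr (ratDen_div_le p r q hq)
  have key : ∀ (x : ℝ) (n : ℤ) (u : ℝ), 0 ≤ u → Q ^ u * |Q * x - n| < ε →
      |x - ((n : ℚ) / ((q : ℕ) : ℚ) : ℚ)| ≤ ε / (L P).q ^ (1 + u) := by
    intro x n u hu hx
    have hq' := (L P).q_pos
    have e : Q * x - n = Q * (x - ((n : ℚ) / ((q : ℕ) : ℚ) : ℚ)) := by
      push_cast; rw [← hQ]; field_simp
    rw [e, abs_mul, abs_of_pos hqr] at hx
    rw [le_div_iff₀ (Real.rpow_pos_of_pos hq' _)]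
    calc _ ≤ |x - ((n : ℚ) / ((q : ℕ) : ℚ) : ℚ)| * Q ^ (1 + u) := by
          have := Real.rpow_le_rpow hq'.le hden (show 0 ≤ 1 + u by linarith)
          gcongr
      _ = Q ^ u * (Q * |x - ((n : ℚ) / ((q : ℕ) : ℚ) : ℚ)|) := by
          rw [Real.rpow_add hqr, Real.rpow_one]; ring
      _ ≤ ε := hx.le
  constructor
  · have := key (v 0) p s hs h1
    rw [hL]; exact this
  · have := key (v 1) r t ht h2
    rw [hL]; exact this

lemma stripProperty_Bad_of_le {s t : ℝ} (hs : 0 ≤ s) (ht : 0 ≤ t) (hst : s + t = 1) (hle : s ≤ t) :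
    StripProperty (Bad s t) := by
  intro R ρ hR hρ
  choose L hL using RatLine.exists_pt_eq (s := s) (t := t) hst
  set K := (6 * ρ * R ^ 2 + 2) * (2 * R ^ 3 * (12 * ρ * R ^ 11)) ^ 2 with hK
  have hK0 : 0 < K := by positivity
  set ε := 1 / (K + 2 * R) with hε
  have hε0 : 0 < ε := by positivity
  have hε1 : (K + 2 * R) * ε = 1 := by rw [hε]; field_simp
  have hRε : 0 < R * ε := by positivity
  have hKε : 0 < K * ε := by positivity
  refine ⟨fun n k => {v | (v 0, v 1) ∈ RatLine.danger L R (12 * ρ * R ^ 11) ε n k}, ?_, ?_⟩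
  · intro v hv
    refine mem_Bad_of_forall_notMem_box hs ht hε0 L hL v fun P hP => ?_
    have hκ : 1 ≤ 12 * ρ * R ^ 11 := by
      have : 1 ≤ R ^ 11 := one_le_pow₀ hR.le
      nlinarith
    obtain ⟨n, k, hc⟩ := (L P).exists_inClass hs ht hR hκ hε0 (by linarith)
    exact hv n k ⟨P, hc, hP⟩
  · intro n k X hX hfree
    obtain ⟨a, b, c, h1, h2⟩ := RatLine.exists_strip hs ht hst hle hR hε0 hρ (by linarith)
      (by linarith) L hL n k (X := (fun v : EuclideanSpace ℝ (Fin 2) => (v 0, v 1)) '' X)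
      (by rintro _ ⟨x, hx, rfl⟩ _ ⟨y, hy, rfl⟩; exact ⟨hX x hx y hy 0, hX x hx y hy 1⟩)
      (by rintro n' k' hn _ ⟨x, hx, rfl⟩; exact hfree n' k' hn x hx)
    exact ⟨a, b, c, h1, fun x hx hxD => h2 _ ⟨x, hx, rfl⟩ hxD⟩

lemma mem_Bad_swap {s t : ℝ} {v : EuclideanSpace ℝ (Fin 2)} (h : !₂[v 1, v 0] ∈ Bad t s) :
    v ∈ Bad s t := by
  rw [Bad, Set.mem_ofPred_eq] at h ⊢
  simpa [max_comm] using h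

theorem stripProperty_Bad {s t : ℝ} (hs : 0 ≤ s) (ht : 0 ≤ t) (hst : s + t = 1) :
    StripProperty (Bad s t) := by
  rcases le_total s t with hle | hle
  · exact stripProperty_Bad_of_le hs ht hst hle
  · intro R ρ hR hρ
    obtain ⟨D, hD1, hD2⟩ := stripProperty_Bad_of_le ht hs (by linarith) hle R ρ hR hρ
    refine ⟨fun n k => {v | !₂[v 1, v 0] ∈ D n k}, fun v hv => mem_Bad_swap (hD1 _ hv), ?_⟩
    intro n k X hX hfree
    obtain ⟨a, b, c, h1, h2⟩ := hD2 n k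
      ((fun v : EuclideanSpace ℝ (Fin 2) => (!₂[v 1, v 0] : EuclideanSpace ℝ (Fin 2))) '' X)
      (by
        rintro _ ⟨x, hx, rfl⟩ _ ⟨y, hy, rfl⟩ i
        fin_cases i
        · exact hX x hx y hy 1
        · exact hX x hx y hy 0)
      (by rintro n' k' hn _ ⟨x, hx, rfl⟩; exact hfree n' k' hn x hx)
    refine ⟨b, a, c, by rwa [max_comm], fun x hx hxD => ?_⟩
    have := h2 _ ⟨x, hx, rfl⟩ hxD
    simp only [Matrix.cons_val_zero, Matrix.cons_val_one] at this
    rwa [add_comm (b * x 0)]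

/-! ### Avoiding obstacles along a path of cells -/

/-- The cells of level greater than `n` below the cell `c` of level `n`. A cell of level `N` is
indexed by a pair of integers; its ancestor `m` levels up is obtained by dividing by `R ^ m`. -/
def cellsBelow (R : ℕ) (n : ℕ) (c : ℤ × ℤ) : Set (ℕ × ℤ × ℤ) :=
  {p | n < p.1 ∧ p.2.1 / (R : ℤ) ^ (p.1 - n) = c.1 ∧ p.2.2 / (R : ℤ) ^ (p.1 - n) = c.2}

/-- The cells of level at least `n` below the cell `c` of level `n`, including `c`. -/
def cellsBelowEq (R : ℕ) (n : ℕ) (c : ℤ × ℤ) : Set (ℕ × ℤ × ℤ) :=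
  {p | n ≤ p.1 ∧ p.2.1 / (R : ℤ) ^ (p.1 - n) = c.1 ∧ p.2.2 / (R : ℤ) ^ (p.1 - n) = c.2}

lemma cellsBelow_subset (R n : ℕ) (c : ℤ × ℤ) : cellsBelow R n c ⊆ cellsBelowEq R n c :=
  fun _ hp => ⟨hp.1.le, hp.2⟩

lemma mk_mem_cellsBelowEq (R n : ℕ) (c : ℤ × ℤ) : (n, c) ∈ cellsBelowEq R n c := by
  simp [cellsBelowEq]

/-- The children of a cell. -/
def childCell (R : ℕ) (c : ℤ × ℤ) (e : Fin R × Fin R) : ℤ × ℤ :=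
  (R * c.1 + (e.1 : ℕ), R * c.2 + (e.2 : ℕ))

lemma childCell_div (R : ℕ) (c : ℤ × ℤ) (e : Fin R × Fin R) :
    (childCell R c e).1 / (R : ℤ) = c.1 ∧ (childCell R c e).2 / (R : ℤ) = c.2 := by
  have key : ∀ (a : ℤ) (i : Fin R), ((R : ℤ) * a + (i : ℕ)) / (R : ℤ) = a := by
    intro a i
    have hi : ((i : ℕ) : ℤ) < R := by exact_mod_cast i.2
    rw [Int.mul_add_ediv_left _ _ (by omega), Int.ediv_eq_zero_of_lt (by omega) hi, add_zero]
  exact ⟨key _ _, key _ _⟩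

lemma cellsBelowEq_childCell_subset (R n : ℕ) (c : ℤ × ℤ) (e : Fin R × Fin R) :
    cellsBelowEq R (n + 1) (childCell R c e) ⊆ cellsBelow R n c := by
  rintro p ⟨h, h1, h2⟩
  have hp : p.1 - n = p.1 - (n + 1) + 1 := by omega
  obtain ⟨e1, e2⟩ := childCell_div R c e
  refine ⟨by omega, ?_, ?_⟩
  · rw [hp, pow_succ, ← Int.ediv_ediv_of_nonneg (by positivity), h1, e1]
  · rw [hp, pow_succ, ← Int.ediv_ediv_of_nonneg (by positivity), h2, e2]

lemma childCell_injective (R : ℕ) (c : ℤ × ℤ) : Function.Injective (childCell R c) := by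
  rintro ⟨i, j⟩ ⟨i', j'⟩ h
  simp only [childCell, Prod.mk.injEq] at h
  refine Prod.ext (Fin.ext ?_) (Fin.ext ?_)
  · have := h.1; simp only; omega
  · have := h.2; simp only; omega

lemma disjoint_cellsBelowEq (R n : ℕ) {c d : ℤ × ℤ} (h : c ≠ d) :
    Disjoint (cellsBelowEq R n c) (cellsBelowEq R n d) := by
  rw [Set.disjoint_left]
  rintro p ⟨-, h1, h2⟩ ⟨-, h3, h4⟩
  exact h (Prod.ext (h1.symm.trans h3) (h2.symm.trans h4))

/-- Some child of a cell carries at most the average of the mass of a set of obstacles. -/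
lemma exists_childCell_measure_le {R : ℕ} (hR : 0 < R) (ν : Measure (ℕ × ℤ × ℤ))
    (F : Set (ℕ × ℤ × ℤ)) (n : ℕ) (c : ℤ × ℤ) {b : ℝ≥0∞}
    (h : ν (F ∩ cellsBelow R n c) ≤ (R : ℝ≥0∞) ^ 2 * b) :
    ∃ e, ν (F ∩ cellsBelowEq R (n + 1) (childCell R c e)) ≤ b := by
  have : NeZero R := ⟨hR.ne'⟩
  obtain ⟨e, -, he⟩ := ENNReal.exists_le_of_sum_le (s := (Finset.univ : Finset (Fin R × Fin R)))
    (f := fun e => ν (F ∩ cellsBelowEq R (n + 1) (childCell R c e))) (g := fun _ => b)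
    Finset.univ_nonempty (by
      rw [← measure_biUnion_finset]
      · simp only [Finset.sum_const, Finset.card_univ, Fintype.card_prod, Fintype.card_fin,
          nsmul_eq_mul]
        rw [Nat.cast_mul, ← sq]
        refine le_trans (measure_mono ?_) h
        exact Set.iUnion₂_subset fun e _ =>
          Set.inter_subset_inter_right _ (cellsBelowEq_childCell_subset R n c e)
      · intro e _ e' _ hee
        exact (disjoint_cellsBelowEq R (n + 1)
          ((childCell_injective R c).ne hee)).mono Set.inter_subset_right Set.inter_subset_right
      · intro e _
        exact (Set.to_countable _).measurableSet)
  exact ⟨e, he⟩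

/-- If at every cell of level `n` new obstacles of mass at most `lam ^ (-n) / 4` are revealed below
it, where `lam ≤ R ^ 2 / 2` and an obstacle of level `N` has mass `lam ^ (-N)`, then there is an
infinite descending path of cells which avoids all the obstacles revealed along it. -/
theorem exists_path_avoiding {R : ℕ} (hR : 0 < R) {lam : ℝ≥0∞} (h0 : lam ≠ 0) (htop : lam ≠ ∞)
    (hlam : 2 * lam ≤ (R : ℝ≥0∞) ^ 2) (ν : Measure (ℕ × ℤ × ℤ))
    (hν : ∀ N c, ν {(N, c)} = (lam ^ N)⁻¹)
    (Obs : ℕ → ℤ × ℤ → Set (ℕ × ℤ × ℤ))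
    (hObs : ∀ n c, ν (Obs n c ∩ cellsBelow R n c) ≤ 4⁻¹ * (lam ^ n)⁻¹) :
    ∃ c : ℕ → ℤ × ℤ, (∀ n, (c (n + 1)).1 / (R : ℤ) = (c n).1 ∧ (c (n + 1)).2 / (R : ℤ) = (c n).2) ∧
      ∀ n N, n < N → (N, c N) ∉ Obs n (c n) := by
  -- A state consists of the current cell and the obstacles revealed so far.
  let Good : ℕ → (ℤ × ℤ) × Set (ℕ × ℤ × ℤ) → Prop := fun n p =>
    ν (p.2 ∩ cellsBelow R n p.1) ≤ 2⁻¹ * (lam ^ n)⁻¹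
  have h24 : (2 : ℝ≥0∞)⁻¹ * 2⁻¹ = 4⁻¹ := by
    rw [← ENNReal.mul_inv (by simp) (by simp)]; norm_num
  have h44 : (4 : ℝ≥0∞)⁻¹ + 4⁻¹ = 2⁻¹ := by
    rw [← h24, ← mul_add, ENNReal.inv_two_add_inv_two, mul_one]
  have step : ∀ n p, Good n p → ∃ e, Good (n + 1)
      (childCell R p.1 e, p.2 ∪ Obs (n + 1) (childCell R p.1 e)) ∧
      (n + 1, childCell R p.1 e) ∉ p.2 := by
    rintro n ⟨c, F⟩ hG
    obtain ⟨e, he⟩ := exists_childCell_measure_le hR ν F n c (b := 4⁻¹ * (lam ^ (n + 1))⁻¹) (by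
      refine le_trans hG ?_
      calc 2⁻¹ * (lam ^ n)⁻¹ = (2 * lam) * (4⁻¹ * (lam ^ (n + 1))⁻¹) := by
            rw [pow_succ, ENNReal.mul_inv (Or.inr htop) (Or.inr h0), ← h24]
            calc 2⁻¹ * (lam ^ n)⁻¹ = 1 * 1 * (2⁻¹ * (lam ^ n)⁻¹) := by ring
              _ = (2 * 2⁻¹) * (lam * lam⁻¹) * (2⁻¹ * (lam ^ n)⁻¹) := by
                  rw [ENNReal.mul_inv_cancel (by simp) (by simp), ENNReal.mul_inv_cancel h0 htop]
              _ = _ := by ring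
        _ ≤ _ := by gcongr)
    have hpos : (lam ^ (n + 1))⁻¹ ≠ 0 := ENNReal.inv_ne_zero.mpr (ENNReal.pow_ne_top htop)
    have hfin : (lam ^ (n + 1))⁻¹ ≠ ∞ := ENNReal.inv_ne_top.mpr (pow_ne_zero _ h0)
    refine ⟨e, ?_, fun hmem => ?_⟩
    · change ν ((F ∪ _) ∩ _) ≤ _
      rw [Set.union_inter_distrib_right, ← h44, add_mul]
      refine (measure_union_le _ _).trans (add_le_add ?_ (hObs _ _))
      exact (measure_mono (Set.inter_subset_inter_right _ (cellsBelow_subset _ _ _))).trans he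
    · have h1 : ν {(n + 1, childCell R c e)} ≤ 4⁻¹ * (lam ^ (n + 1))⁻¹ :=
        (measure_mono (Set.singleton_subset_iff.mpr (Set.mem_inter hmem
          (mk_mem_cellsBelowEq R (n + 1) _)))).trans he
      rw [hν] at h1
      have h2 : 4⁻¹ * (lam ^ (n + 1))⁻¹ < 1 * (lam ^ (n + 1))⁻¹ :=
        (ENNReal.mul_lt_mul_iff_left hpos hfin).mpr
          (ENNReal.inv_lt_one.mpr (by norm_num))
      rw [one_mul] at h2
      exact (h1.trans_lt h2).false
  have start : Good 0 ((0, 0), Obs 0 (0, 0)) := by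
    refine (hObs 0 (0, 0)).trans ?_
    gcongr
    norm_num
  let next : ∀ n, {p // Good n p} → {p // Good (n + 1) p} := fun n p =>
    ⟨_, (step n p.1 p.2).choose_spec.1⟩
  let path : ∀ n, {p // Good n p} := fun n => Nat.rec ⟨_, start⟩ next n
  have hmono : ∀ n N, n ≤ N → Obs n (path n).1.1 ⊆ (path N).1.2 := by
    intro n N h
    induction N, h using Nat.le_induction with
    | base =>
      cases n with
      | zero => exact subset_rfl
      | succ n => exact Set.subset_union_right
    | succ N _ ih => exact ih.trans Set.subset_union_left
  refine ⟨fun n => (path n).1.1, fun n => childCell_div R _ _, fun n N h => ?_⟩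
  obtain ⟨m, rfl⟩ : ∃ m, N = m + 1 := ⟨N - 1, by omega⟩
  exact fun hmem => (step m (path m).1 (path m).2).choose_spec.2 (hmono n m (by omega) hmem)

/-! ### Counting cells met by a strip -/

/-- The closed square of side `w` with index `c`. -/
def cell (w : ℝ) (c : ℤ × ℤ) : Set (EuclideanSpace ℝ (Fin 2)) :=
  {x | (c.1 * w ≤ x 0 ∧ x 0 ≤ (c.1 + 1) * w) ∧ (c.2 * w ≤ x 1 ∧ x 1 ≤ (c.2 + 1) * w)}

/-- The cells of level `N`, of side `w`, which meet the set `U`. -/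
def cellsMeeting (w : ℝ) (N : ℕ) (U : Set (EuclideanSpace ℝ (Fin 2))) : Set (ℕ × ℤ × ℤ) :=
  {p | p.1 = N ∧ (cell w p.2 ∩ U).Nonempty}

lemma norm_le_abs_add_abs (v : EuclideanSpace ℝ (Fin 2)) : ‖v‖ ≤ |v 0| + |v 1| := by
  rw [EuclideanSpace.norm_eq, Fin.sum_univ_two]
  refine Real.sqrt_le_iff.mpr ⟨by positivity, ?_⟩
  simp only [Real.norm_eq_abs]
  nlinarith [abs_nonneg (v 0), abs_nonneg (v 1)]

lemma abs_sub_apply_le (x y : EuclideanSpace ℝ (Fin 2)) (i : Fin 2) : |x i - y i| ≤ ‖x - y‖ := by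
  simpa using PiLp.norm_apply_le (x - y) i

lemma norm_sub_le_of_mem_cell {w : ℝ} {c : ℤ × ℤ} {x y : EuclideanSpace ℝ (Fin 2)}
    (hx : x ∈ cell w c) (hy : y ∈ cell w c) : ‖x - y‖ ≤ 2 * w := by
  obtain ⟨⟨a1, a2⟩, a3, a4⟩ := hx
  obtain ⟨⟨b1, b2⟩, b3, b4⟩ := hy
  have h0 : |(x - y) 0| ≤ w := by rw [PiLp.sub_apply, abs_le]; constructor <;> linarith
  have h1 : |(x - y) 1| ≤ w := by rw [PiLp.sub_apply, abs_le]; constructor <;> linarith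
  linarith [norm_le_abs_add_abs (x - y)]

lemma measure_cellsMeeting_le_of_abs_sub_le {lam : ℝ≥0∞} (ν : Measure (ℕ × ℤ × ℤ))
    (hν : ∀ N c, ν {(N, c)} = (lam ^ N)⁻¹) {w : ℝ} (hw : 0 < w) (N l : ℕ)
    {U : Set (EuclideanSpace ℝ (Fin 2))} (hU : ∀ x ∈ U, ∀ y ∈ U, ∀ i, |x i - y i| ≤ l * w) :
    ν (cellsMeeting w N U) ≤ ((2 * l + 3) ^ 2 : ℕ) * (lam ^ N)⁻¹ := by
  rcases (cellsMeeting w N U).eq_empty_or_nonempty with h | ⟨⟨N', c⟩, hN, x, hxc, hx⟩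
  · rw [h, measure_empty]; exact zero_le
  simp only at hN
  subst hN
  have key : ∀ (m n : ℤ) (a b : ℝ), m * w ≤ a → b ≤ (n + 1) * w → |a - b| ≤ l * w →
      m ≤ n + (l + 1) := by
    intro m n a b h1 h2 h3
    have h4 : (m : ℝ) * w ≤ (n + (l + 1)) * w := by
      have := (abs_le.mp h3).2
      nlinarith
    exact_mod_cast le_of_mul_le_mul_right h4 hw
  set I : Finset (ℤ × ℤ) := Finset.Icc (c.1 - (l + 1)) (c.1 + (l + 1)) ×ˢ
    Finset.Icc (c.2 - (l + 1)) (c.2 + (l + 1)) with hI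
  have hsub : cellsMeeting w N' U ⊆ ⋃ d ∈ I, {(N', d)} := by
    rintro ⟨N, d⟩ ⟨rfl, y, hyd, hy⟩
    refine Set.mem_biUnion (x := d) ?_ rfl
    obtain ⟨⟨a1, a2⟩, a3, a4⟩ := hxc
    obtain ⟨⟨b1, b2⟩, b3, b4⟩ := hyd
    have k1 := key d.1 c.1 _ _ b1 a2 (hU y hy x hx 0)
    have k2 := key c.1 d.1 _ _ a1 b2 (hU x hx y hy 0)
    have k3 := key d.2 c.2 _ _ b3 a4 (hU y hy x hx 1)
    have k4 := key c.2 d.2 _ _ a3 b4 (hU x hx y hy 1)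
    simp only [hI, Finset.coe_product, Finset.coe_Icc, Set.mem_prod, Set.mem_Icc]
    omega
  calc ν (cellsMeeting w N' U) ≤ ν (⋃ d ∈ I, {(N', d)}) := measure_mono hsub
    _ ≤ ∑ d ∈ I, ν {(N', d)} := measure_biUnion_finset_le _ _
    _ = ((2 * l + 3) ^ 2 : ℕ) * (lam ^ N')⁻¹ := by
        simp only [hν, Finset.sum_const, nsmul_eq_mul]
        congr 2
        rw [hI, Finset.card_product, Int.card_Icc, Int.card_Icc, sq]
        congr 1 <;> omega

/-- The number of cells of a given level which the image of a strip may meet, relative to the ratio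
of the length and the width of the strip. -/
noncomputable def stripConst (M : ℝ) : ℕ := (2 * ⌈2 * M⌉₊ + 1) * (2 * ⌈4 * M⌉₊ + 3) ^ 2

/-- The image under a Lipschitz map of a piece of a strip of width `w` and length of the order of
`K w` meets `O(K)` cells of side `w`: cut the piece into `O(K)` pieces of diameter `O(w)`. -/
lemma measure_cellsMeeting_image_le {lam : ℝ≥0∞} (ν : Measure (ℕ × ℤ × ℤ))
    (hν : ∀ N c, ν {(N, c)} = (lam ^ N)⁻¹) {w M : ℝ} (hw : 0 < w) (N K : ℕ) (hK : 1 ≤ K)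
    (hM : 0 ≤ M) (f : EuclideanSpace ℝ (Fin 2) → EuclideanSpace ℝ (Fin 2))
    (hf : ∀ x y, ‖f x - f y‖ ≤ M * ‖x - y‖) {Z : Set (EuclideanSpace ℝ (Fin 2))}
    (hZ : ∀ x ∈ Z, ∀ y ∈ Z, ∀ i, |x i - y i| ≤ 2 * M * (K * w))
    {a b c : ℝ} (hab : max |a| |b| = 1) (hstrip : ∀ x ∈ Z, |a * x 0 + b * x 1 + c| ≤ w) :
    ν (cellsMeeting w N (f '' Z)) ≤ (stripConst M * K : ℕ) * (lam ^ N)⁻¹ := by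
  rcases Z.eq_empty_or_nonempty with rfl | ⟨z, hz⟩
  · simp [cellsMeeting]
  -- Within the strip, the coordinate `i` controls the whole vector up to an error `O(w)`.
  obtain ⟨i, hi⟩ : ∃ i : Fin 2, ∀ x ∈ Z, ∀ y ∈ Z, ‖x - y‖ ≤ 2 * |x i - y i| + 2 * w := by
    have aux : ∀ α β u v : ℝ, |α| ≤ 1 → |β| = 1 → |α * u + β * v| ≤ 2 * w → |v| ≤ |u| + 2 * w := by
      intro α β u v hα hβ h
      have h1 : |v| = |β * v| := by rw [abs_mul, hβ, one_mul]
      have h2 : |α * u| ≤ |u| := by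
        rw [abs_mul]; exact mul_le_of_le_one_left (abs_nonneg _) hα
      have h3 : |β * v| ≤ |α * u + β * v| + |α * u| := by
        have := abs_sub (α * u + β * v) (α * u)
        rwa [add_sub_cancel_left] at this
      linarith
    have diff : ∀ x ∈ Z, ∀ y ∈ Z, |a * (x 0 - y 0) + b * (x 1 - y 1)| ≤ 2 * w := by
      intro x hx y hy
      have h1 := abs_sub (a * x 0 + b * x 1 + c) (a * y 0 + b * y 1 + c)
      have h2 := hstrip x hx
      have h3 := hstrip y hy
      have e : a * (x 0 - y 0) + b * (x 1 - y 1)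
        = (a * x 0 + b * x 1 + c) - (a * y 0 + b * y 1 + c) := by ring
      rw [e]; linarith
    have ha : |a| ≤ 1 := hab ▸ le_max_left _ _
    have hb : |b| ≤ 1 := hab ▸ le_max_right _ _
    rcases max_choice |a| |b| with h | h
    · refine ⟨1, fun x hx y hy => ?_⟩
      have h1 := aux b a (x 1 - y 1) (x 0 - y 0) hb (h ▸ hab) (by
        rw [add_comm]; exact diff x hx y hy)
      have h2 := norm_le_abs_add_abs (x - y)
      rw [PiLp.sub_apply, PiLp.sub_apply] at h2
      linarith
    · refine ⟨0, fun x hx y hy => ?_⟩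
      have h1 := aux a b (x 0 - y 0) (x 1 - y 1) ha (h ▸ hab) (diff x hx y hy)
      have h2 := norm_le_abs_add_abs (x - y)
      rw [PiLp.sub_apply, PiLp.sub_apply] at h2
      linarith
  set T : ℕ := ⌈2 * M⌉₊ * K with hT
  let piece : ℤ → Set (EuclideanSpace ℝ (Fin 2)) := fun τ => {x | x ∈ Z ∧ ⌊(x i - z i) / w⌋ = τ}
  have hsub : cellsMeeting w N (f '' Z) ⊆
      ⋃ τ ∈ Finset.Icc (-(T : ℤ)) T, cellsMeeting w N (f '' piece τ) := by
    rintro p ⟨hp, _, hyc, x, hx, rfl⟩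
    refine Set.mem_biUnion (x := ⌊(x i - z i) / w⌋) ?_ ⟨hp, _, hyc, x, ⟨hx, rfl⟩, rfl⟩
    have h1 : |(x i - z i) / w| ≤ T := by
      rw [abs_div, abs_of_pos hw, div_le_iff₀ hw, hT]
      push_cast
      calc _ ≤ 2 * M * (K * w) := hZ x hx z hz i
        _ ≤ ⌈2 * M⌉₊ * (K * w) := by have := Nat.le_ceil (2 * M); gcongr
        _ = _ := by ring
    rw [abs_le] at h1
    rw [Finset.coe_Icc, Set.mem_Icc]
    refine ⟨Int.le_floor.mpr (by push_cast; exact h1.1), ?_⟩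
    have h2 := (Int.floor_le ((x i - z i) / w)).trans h1.2
    exact Int.cast_le.mp (h2.trans_eq (Int.cast_natCast T).symm)
  have hpiece : ∀ τ, ν (cellsMeeting w N (f '' piece τ)) ≤
      ((2 * ⌈4 * M⌉₊ + 3) ^ 2 : ℕ) * (lam ^ N)⁻¹ := by
    intro τ
    refine measure_cellsMeeting_le_of_abs_sub_le ν hν hw N _ ?_
    rintro _ ⟨x, ⟨hx, hxτ⟩, rfl⟩ _ ⟨y, ⟨hy, hyτ⟩, rfl⟩ j
    have h1 : |x i - y i| ≤ w := by
      have := Int.abs_sub_lt_one_of_floor_eq_floor (hxτ.trans hyτ.symm)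
      rw [← sub_div, sub_sub_sub_cancel_right, abs_div, abs_of_pos hw, div_lt_one hw] at this
      exact this.le
    calc _ ≤ ‖f x - f y‖ := abs_sub_apply_le _ _ _
      _ ≤ M * ‖x - y‖ := hf x y
      _ ≤ M * (4 * w) := by
          have := hi x hx y hy
          gcongr
          linarith
      _ = 4 * M * w := by ring
      _ ≤ ⌈4 * M⌉₊ * w := by have := Nat.le_ceil (4 * M); gcongr
  calc _ ≤ ν (⋃ τ ∈ Finset.Icc (-(T : ℤ)) T, cellsMeeting w N (f '' piece τ)) := measure_mono hsub
    _ ≤ ∑ τ ∈ Finset.Icc (-(T : ℤ)) T, ν (cellsMeeting w N (f '' piece τ)) :=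
        measure_biUnion_finset_le _ _
    _ ≤ ∑ τ ∈ Finset.Icc (-(T : ℤ)) T, ((2 * ⌈4 * M⌉₊ + 3) ^ 2 : ℕ) * (lam ^ N)⁻¹ :=
        Finset.sum_le_sum fun τ _ => hpiece τ
    _ = ((2 * T + 1) * (2 * ⌈4 * M⌉₊ + 3) ^ 2 : ℕ) * (lam ^ N)⁻¹ := by
        rw [Finset.sum_const, Int.card_Icc, nsmul_eq_mul, ← mul_assoc, ← Nat.cast_mul]
        congr 3
        omega
    _ ≤ _ := by
        have e : stripConst M * K = (2 * ⌈2 * M⌉₊ + 1) * K * (2 * ⌈4 * M⌉₊ + 3) ^ 2 := by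
          rw [stripConst]; ring
        have h1 : 2 * T + 1 ≤ (2 * ⌈2 * M⌉₊ + 1) * K := by rw [hT]; nlinarith
        rw [e]
        exact mul_le_mul_left (Nat.cast_le.mpr (Nat.mul_le_mul_right _ h1)) _

/-! ### Obstacles attached to the image of a set with the strip property -/

lemma cell_subset_cell {R : ℕ} (hR : 0 < R) {n : ℕ} {c d : ℤ × ℤ} (h1 : d.1 / (R : ℤ) = c.1)
    (h2 : d.2 / (R : ℤ) = c.2) : cell ((R : ℝ) ^ (n + 1))⁻¹ d ⊆ cell ((R : ℝ) ^ n)⁻¹ c := by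
  have hRr : (0 : ℝ) < R := by exact_mod_cast hR
  have hRz : (0 : ℤ) < R := by exact_mod_cast hR
  set w := ((R : ℝ) ^ (n + 1))⁻¹ with hw
  have hw0 : 0 < w := by positivity
  have e : ((R : ℝ) ^ n)⁻¹ = R * w := by rw [hw, pow_succ]; field_simp
  rw [e]
  have key : ∀ (m k : ℤ) (x : ℝ), k / (R : ℤ) = m → k * w ≤ x ∧ x ≤ (k + 1) * w →
      m * (R * w) ≤ x ∧ x ≤ (m + 1) * (R * w) := by
    rintro m k x rfl ⟨h3, h4⟩
    have h5 : ((k / (R : ℤ) : ℤ) : ℝ) * R ≤ k := by exact_mod_cast Int.ediv_mul_le k hRz.ne'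
    have h6 : (k : ℝ) + 1 ≤ (((k / (R : ℤ) : ℤ) : ℝ) + 1) * R := by
      exact_mod_cast Int.lt_ediv_add_one_mul_self k hRz
    constructor <;> nlinarith
  exact fun x hx => ⟨key _ _ _ h1 hx.1, key _ _ _ h2 hx.2⟩

lemma cell_antitone {R : ℕ} (hR : 0 < R) {c : ℕ → ℤ × ℤ}
    (hc : ∀ n, (c (n + 1)).1 / (R : ℤ) = (c n).1 ∧ (c (n + 1)).2 / (R : ℤ) = (c n).2) :
    Antitone fun n => cell ((R : ℝ) ^ n)⁻¹ (c n) :=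
  antitone_nat_of_succ_le fun n => cell_subset_cell hR (hc n).1 (hc n).2

/-- Avoiding the bi-Lipschitz image of the complement of a set with the strip property amounts to
avoiding obstacles along a path of cells. The sets `D n k` are formed with respect to the base
`R ^ J`, and obstacles are revealed at the levels divisible by `J` only. -/
lemma StripProperty.exists_obstacles {S : Set (EuclideanSpace ℝ (Fin 2))} (hS : StripProperty S)
    {M : ℝ} (hM : 1 ≤ M) (f : EuclideanSpace ℝ (Fin 2) ≃ₜ EuclideanSpace ℝ (Fin 2))
    (hf : ∀ x y, M⁻¹ * ‖x - y‖ ≤ ‖f x - f y‖ ∧ ‖f x - f y‖ ≤ M * ‖x - y‖)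
    {R : ℕ} (hR : 2 ≤ R) {J : ℕ} (hJ : 0 < J) {lam : ℝ≥0∞} (ν : Measure (ℕ × ℤ × ℤ))
    (hν : ∀ N c, ν {(N, c)} = (lam ^ N)⁻¹) :
    ∃ Obs : ℕ → ℤ × ℤ → Set (ℕ × ℤ × ℤ),
      (∀ n c, ν (Obs n c) ≤
        ∑' k : ℕ, (stripConst M * R ^ ((k + 1) * J) : ℕ) * (lam ^ (n + (k + 1) * J))⁻¹) ∧
      ∀ c : ℕ → ℤ × ℤ,
        (∀ n, (c (n + 1)).1 / (R : ℤ) = (c n).1 ∧ (c (n + 1)).2 / (R : ℤ) = (c n).2) →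
        (∀ n N, n < N → (N, c N) ∉ Obs n (c n)) →
        ∀ x, (∀ n, x ∈ cell ((R : ℝ) ^ n)⁻¹ (c n)) → x ∈ f '' S := by
  classical
  have hR1 : (1 : ℝ) < R := by exact_mod_cast hR
  have hR0 : (0 : ℝ) < R := by linarith
  obtain ⟨D, hD1, hD2⟩ := hS ((R : ℝ) ^ J) (2 * M) (one_lt_pow₀ hR1 hJ.ne') (by linarith)
  -- A cell is free if it avoids all the sets `D n' k'` of width at least its side.
  let Free : ℕ → ℤ × ℤ → Prop := fun n c => ∀ n' k', (n' + k' + 1) * J ≤ n →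
    ∀ x ∈ cell ((R : ℝ) ^ n)⁻¹ c, f.symm x ∉ D n' k'
  let Obs : ℕ → ℤ × ℤ → Set (ℕ × ℤ × ℤ) := fun n c =>
    {p | J ∣ n ∧ Free n c ∧ ∃ k, p ∈ cellsMeeting ((R : ℝ) ^ (n + (k + 1) * J))⁻¹
      (n + (k + 1) * J) (f '' {x | f x ∈ cell ((R : ℝ) ^ n)⁻¹ c ∧ x ∈ D (n / J) k})}
  refine ⟨Obs, fun n c => ?_, fun c hc hav x hx => ?_⟩
  · by_cases hn : J ∣ n ∧ Free n c
    swap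
    · have : Obs n c = ∅ := by
        ext p
        exact ⟨fun hp => hn ⟨hp.1, hp.2.1⟩, fun hp => hp.elim⟩
      rw [this, measure_empty]
      exact zero_le
    obtain ⟨⟨m, rfl⟩, hfree⟩ := hn
    have hsub : Obs (J * m) c ⊆ ⋃ k, cellsMeeting ((R : ℝ) ^ (J * m + (k + 1) * J))⁻¹
      (J * m + (k + 1) * J) (f '' {x | f x ∈ cell ((R : ℝ) ^ (J * m))⁻¹ c ∧ x ∈ D m k}) := by
      rintro p ⟨-, -, k, hk⟩
      rw [Nat.mul_div_cancel_left m hJ] at hk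
      exact Set.mem_iUnion.mpr ⟨k, hk⟩
    refine (measure_mono hsub).trans ((measure_iUnion_le _).trans
      (ENNReal.tsum_le_tsum fun k => ?_))
    have hX : ∀ x ∈ f ⁻¹' cell ((R : ℝ) ^ (J * m))⁻¹ c, ∀ y ∈ f ⁻¹' cell ((R : ℝ) ^ (J * m))⁻¹ c,
        ∀ i, |x i - y i| ≤ 2 * M * ((R : ℝ) ^ (J * m))⁻¹ := by
      intro x hx y hy i
      have h1 : ‖x - y‖ ≤ M * ‖f x - f y‖ := by
        rw [← inv_mul_le_iff₀ (by linarith)]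
        exact (hf x y).1
      calc _ ≤ ‖x - y‖ := abs_sub_apply_le x y i
        _ ≤ M * ‖f x - f y‖ := h1
        _ ≤ M * (2 * ((R : ℝ) ^ (J * m))⁻¹) := by
            have := norm_sub_le_of_mem_cell hx hy
            gcongr
        _ = _ := by ring
    obtain ⟨α, β, γ, h1, h2⟩ := hD2 m k (f ⁻¹' cell ((R : ℝ) ^ (J * m))⁻¹ c)
      (by rw [← pow_mul]; exact hX)
      (fun n' k' h x hx => by
        have := hfree n' k' (by rw [mul_comm J]; exact Nat.mul_le_mul_right J h) (f x) hx
        rwa [f.symm_apply_apply] at this)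
    refine measure_cellsMeeting_image_le (c := γ) ν hν (by positivity) _ _ (Nat.one_le_pow _ _ (by omega))
      (by linarith) f (fun x y => (hf x y).2) ?_ h1 ?_
    · rintro x ⟨hx, -⟩ y ⟨hy, -⟩ i
      refine (hX x hx y hy i).trans_eq ?_
      push_cast
      rw [pow_add]
      field_simp
    · rintro x ⟨hx, hxD⟩
      refine (h2 x hx hxD).trans_eq ?_
      rw [← pow_mul]
      congr 2
      ring
  · have hanti := cell_antitone (by omega : 0 < R) hc
    have claim : ∀ m n k, n + k + 1 = m →
        ∀ y ∈ cell ((R : ℝ) ^ ((n + k + 1) * J))⁻¹ (c ((n + k + 1) * J)), f.symm y ∉ D n k := by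
      intro m
      induction m using Nat.strong_induction_on with
      | _ m ih =>
        rintro n k rfl y hy hyD
        have e : J * n + (k + 1) * J = (n + k + 1) * J := by ring
        have hlt : J * n < (n + k + 1) * J := by nlinarith
        refine hav (J * n) ((n + k + 1) * J) hlt ⟨dvd_mul_right _ _, ?_, k, ?_⟩
        · intro n' k' h z hz
          have h' : n' + k' + 1 ≤ n := by
            rw [mul_comm J] at h
            exact Nat.le_of_mul_le_mul_right h hJ
          exact ih (n' + k' + 1) (by omega) n' k' rfl z (hanti h hz)
        · rw [e, Nat.mul_div_cancel_left n hJ]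
          refine ⟨rfl, y, hy, f.symm y, ⟨?_, hyD⟩, f.apply_symm_apply y⟩
          rw [f.apply_symm_apply]
          exact hanti hlt.le hy
    exact ⟨f.symm x, hD1 _ fun n k => claim _ n k rfl x (hx _), f.apply_symm_apply x⟩

/-! ### Covers of small Hausdorff sum as obstacles -/

lemma exists_cover_of_hausdorffMeasure_eq_zero {X : Type*} [EMetricSpace X] [MeasurableSpace X]
    [BorelSpace X] {d : ℝ} (hd : 0 < d) {A : Set X} (h : μH[d] A = 0) {r δ : ℝ≥0∞} (hr : 0 < r)
    (hδ : 0 < δ) : ∃ U : ℕ → Set X, A ⊆ ⋃ i, U i ∧ (∀ i, Metric.ediam (U i) ≤ r) ∧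
      ∑' i, Metric.ediam (U i) ^ d < δ := by
  rw [Measure.hausdorffMeasure_apply, ← bot_eq_zero, iSup_eq_bot] at h
  have h1 := h r
  rw [iSup_eq_bot] at h1
  have h2 := (h1 hr).trans_lt (show ⊥ < δ from hδ)
  simp only [iInf_lt_iff] at h2
  obtain ⟨U, hU, hUr, hsum⟩ := h2
  refine ⟨U, hU, hUr, lt_of_le_of_lt (ENNReal.tsum_le_tsum fun i => ?_) hsum⟩
  rcases (U i).eq_empty_or_nonempty with he | he
  · rw [he, Metric.ediam_empty, ENNReal.zero_rpow_of_pos hd]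
    exact zero_le
  · exact le_iSup (fun _ : (U i).Nonempty => Metric.ediam (U i) ^ d) he

/-- A level whose cells are at least as large as a given `a`, but not much larger. The error term
`e` accounts for `a = 0`. -/
lemma exists_level {R d a e : ℝ} (hR : 1 < R) (hd : 1 ≤ d) (ha : 0 ≤ a) (haR : a ≤ R⁻¹)
    (he : 0 < e) : ∃ m : ℕ, 0 < m ∧ a ≤ (R ^ m)⁻¹ ∧ ((R ^ m)⁻¹) ^ d ≤ (R * a) ^ d + e := by
  have hR0 : 0 < R := by linarith
  rcases ha.eq_or_lt with rfl | ha
  · obtain ⟨m, hm⟩ := exists_pow_lt_of_lt_one he (inv_lt_one_of_one_lt₀ hR)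
    refine ⟨m + 1, m.succ_pos, by positivity, ?_⟩
    have h1 : (R ^ (m + 1))⁻¹ ≤ 1 := inv_le_one_of_one_le₀ (one_le_pow₀ hR.le)
    calc ((R ^ (m + 1))⁻¹) ^ d ≤ ((R ^ (m + 1))⁻¹) ^ (1 : ℝ) :=
          Real.rpow_le_rpow_of_exponent_ge (by positivity) h1 hd
      _ = R⁻¹ ^ (m + 1) := by rw [Real.rpow_one, inv_pow]
      _ ≤ R⁻¹ ^ m := pow_le_pow_of_le_one (by positivity) (inv_le_one_of_one_le₀ hR.le) m.le_succ
      _ ≤ (R * 0) ^ d + e := by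
          have : 0 ≤ (R * 0) ^ d := Real.rpow_nonneg (by simp) _
          linarith
  · obtain ⟨n, h1, h2⟩ := exists_nat_mul_pow_le_lt hR hR0 ((le_inv_comm₀ ha hR0).mp haR)
    refine ⟨n + 1, n.succ_pos, ?_, ?_⟩
    · rw [pow_succ']; exact (le_inv_comm₀ (by positivity) ha).mp h1
    · have h3 : (R ^ (n + 1))⁻¹ ≤ R * a := by
        rw [inv_le_iff_one_le_mul₀ (by positivity)]
        have := (mul_lt_mul_of_pos_left h2 ha).le
        rw [mul_inv_cancel₀ ha.ne'] at this
        linarith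
      have := Real.rpow_le_rpow (by positivity) h3 (show 0 ≤ d by linarith)
      linarith

/-- A cover of small Hausdorff sum can be replaced by obstacles of small total mass. -/
lemma exists_cover_obstacles {d : ℝ} (hd : 1 ≤ d) {R : ℕ} (hR : 2 ≤ R)
    (ν : Measure (ℕ × ℤ × ℤ))
    (hν : ∀ N c, ν {(N, c)} = (ENNReal.ofReal ((R : ℝ) ^ d) ^ N)⁻¹)
    {A : Set (EuclideanSpace ℝ (Fin 2))} (hA : μH[d] A = 0) {δ : ℝ≥0∞} (hδ : δ ≠ 0) :
    ∃ O : Set (ℕ × ℤ × ℤ), ν O ≤ δ ∧ ∀ c : ℕ → ℤ × ℤ, (∀ N, 0 < N → (N, c N) ∉ O) →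
      ∀ x, (∀ n, x ∈ cell ((R : ℝ) ^ n)⁻¹ (c n)) → x ∉ A := by
  have hR1 : (1 : ℝ) < R := by exact_mod_cast hR
  have hR0 : (0 : ℝ) < R := by linarith
  set lam := ENNReal.ofReal ((R : ℝ) ^ d) with hlam
  have hlam0 : lam ≠ 0 := by
    rw [hlam, Ne, ENNReal.ofReal_eq_zero, not_le]; positivity
  have hδ' : δ / (25 * 2) ≠ 0 := (ENNReal.div_pos hδ (by finiteness)).ne'
  obtain ⟨e, he0, he⟩ := ENNReal.exists_pos_sum_of_countable hδ' ℕ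
  obtain ⟨U, hAU, hUr, hUsum⟩ := exists_cover_of_hausdorffMeasure_eq_zero (by linarith) hA
    (r := ENNReal.ofReal (R : ℝ)⁻¹) (δ := δ / (25 * 2) / lam)
    (ENNReal.ofReal_pos.mpr (by positivity)) (ENNReal.div_pos hδ' ENNReal.ofReal_ne_top)
  have hfin : ∀ i, Metric.ediam (U i) ≠ ∞ := fun i =>
    ne_top_of_le_ne_top ENNReal.ofReal_ne_top (hUr i)
  have hlev : ∀ i, ∃ m : ℕ, 0 < m ∧ (Metric.ediam (U i)).toReal ≤ ((R : ℝ) ^ m)⁻¹ ∧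
      (lam ^ m)⁻¹ ≤ lam * Metric.ediam (U i) ^ d + e i := by
    intro i
    obtain ⟨m, h1, h2, h3⟩ := exists_level hR1 hd (a := (Metric.ediam (U i)).toReal)
      ENNReal.toReal_nonneg (ENNReal.toReal_le_of_le_ofReal (by positivity) (hUr i))
      (show (0 : ℝ) < e i from he0 i)
    refine ⟨m, h1, h2, ?_⟩
    have e1 : (lam ^ m)⁻¹ = ENNReal.ofReal ((((R : ℝ) ^ m)⁻¹) ^ d) := by
      rw [hlam, ← ENNReal.ofReal_pow (by positivity), ← ENNReal.ofReal_inv_of_pos (by positivity)]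
      congr 1
      rw [Real.inv_rpow (by positivity), Real.rpow_pow_comm hR0.le]
    rw [e1]
    refine (ENNReal.ofReal_le_ofReal h3).trans ?_
    rw [ENNReal.ofReal_add (by positivity) (NNReal.coe_nonneg _),
      Real.mul_rpow hR0.le ENNReal.toReal_nonneg, ENNReal.ofReal_mul (by positivity),
      ENNReal.ofReal_coe_nnreal, ← ENNReal.ofReal_rpow_of_nonneg ENNReal.toReal_nonneg (by linarith),
      ENNReal.ofReal_toReal (hfin i)]
  choose m hm0 hmU hmlam using hlev
  refine ⟨⋃ i, cellsMeeting ((R : ℝ) ^ m i)⁻¹ (m i) (U i), ?_, ?_⟩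
  · calc _ ≤ ∑' i, ν (cellsMeeting ((R : ℝ) ^ m i)⁻¹ (m i) (U i)) := measure_iUnion_le _
      _ ≤ ∑' i, 25 * (lam * Metric.ediam (U i) ^ d + e i) := by
          refine ENNReal.tsum_le_tsum fun i => ?_
          refine (measure_cellsMeeting_le_of_abs_sub_le ν hν (by positivity) (m i) 1 ?_).trans ?_
          · intro x hx y hy j
            have h1 : dist x y ≤ (Metric.ediam (U i)).toReal := by
              rw [dist_edist]
              exact ENNReal.toReal_mono (hfin i) (Metric.edist_le_ediam_of_mem hx hy)
            rw [dist_eq_norm] at h1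
            rw [Nat.cast_one, one_mul]
            exact (abs_sub_apply_le x y j).trans (h1.trans (hmU i))
          · norm_num
            exact mul_le_mul_right (hmlam i) _
      _ = 25 * (lam * ∑' i, Metric.ediam (U i) ^ d + ∑' i, (e i : ℝ≥0∞)) := by
          rw [ENNReal.tsum_mul_left, ENNReal.tsum_add, ENNReal.tsum_mul_left]
      _ ≤ 25 * (lam * (δ / (25 * 2) / lam) + δ / (25 * 2)) := by gcongr
      _ = δ := by
          rw [ENNReal.mul_div_cancel hlam0 ENNReal.ofReal_ne_top, ← two_mul, ← mul_assoc,
            ENNReal.mul_div_cancel (by norm_num) (by finiteness)]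
  · intro c hc x hx hxA
    obtain ⟨i, hi⟩ := Set.mem_iUnion.mp (hAU hxA)
    exact hc (m i) (hm0 i) (Set.mem_iUnion.mpr ⟨i, rfl, x, hx _, hi⟩)

/-! ### Countable intersections of bi-Lipschitz images -/

lemma isClosed_cell (w : ℝ) (c : ℤ × ℤ) : IsClosed (cell w c) := by
  have h : ∀ i : Fin 2, Continuous fun x : EuclideanSpace ℝ (Fin 2) => x i := fun i => by fun_prop
  exact ((isClosed_le continuous_const (h 0)).inter (isClosed_le (h 0) continuous_const)).inter
    ((isClosed_le continuous_const (h 1)).inter (isClosed_le (h 1) continuous_const))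

lemma isCompact_cell (w : ℝ) (c : ℤ × ℤ) : IsCompact (cell w c) := by
  refine Metric.isCompact_of_isClosed_isBounded (isClosed_cell w c) ?_
  refine Metric.isBounded_iff.mpr ⟨2 * w, fun x hx y hy => ?_⟩
  rw [dist_eq_norm]
  exact norm_sub_le_of_mem_cell hx hy

lemma nonempty_cell {w : ℝ} (hw : 0 ≤ w) (c : ℤ × ℤ) : (cell w c).Nonempty :=
  ⟨!₂[c.1 * w, c.2 * w], ⟨⟨le_rfl, by change (c.1 : ℝ) * w ≤ _; nlinarith⟩,
    ⟨le_rfl, by change (c.2 : ℝ) * w ≤ _; nlinarith⟩⟩⟩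

/-- The total mass of the obstacles which are revealed at one cell. -/
lemma tsum_obstacles_le {R lam : ℝ≥0∞} (h0 : lam ≠ 0) (htop : lam ≠ ∞) (C : ℕ)
    (h : R * (32 * C + 2) ≤ lam) (n : ℕ) :
    ∑' j : ℕ, ∑' k : ℕ, (C * R ^ ((k + 1) * (j + 1))) * (lam ^ (n + (k + 1) * (j + 1)))⁻¹ ≤
      8⁻¹ * (lam ^ n)⁻¹ := by
  set y := R * lam⁻¹ with hy
  have hy1 : (32 * C + 2) * y ≤ 1 := by
    rw [hy, ← mul_assoc, mul_comm _ R, ← div_eq_mul_inv]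
    exact ENNReal.div_le_of_le_mul (by rwa [one_mul])
  have hy2 : 2 * y ≤ 1 := le_trans (by gcongr; exact le_add_self) hy1
  have hy3 : y ≤ 1 := le_trans (by rw [two_mul]; exact le_add_self) hy2
  have hy4 : (1 - y)⁻¹ ≤ 2 := by
    rw [ENNReal.inv_le_iff_inv_le]
    refine ENNReal.le_sub_of_add_le_right (ne_top_of_le_ne_top ENNReal.one_ne_top hy3) ?_
    calc 2⁻¹ + y ≤ 2⁻¹ + 2⁻¹ := by
          gcongr
          rw [ENNReal.le_inv_iff_mul_le, mul_comm]
          exact hy2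
      _ = 1 := ENNReal.inv_two_add_inv_two
  have term : ∀ j k : ℕ, (C * R ^ ((k + 1) * (j + 1))) * (lam ^ (n + (k + 1) * (j + 1)))⁻¹ ≤
      (C * (lam ^ n)⁻¹ * y) * (y ^ j * y ^ k) := by
    intro j k
    calc _ = C * (lam ^ n)⁻¹ * y ^ ((k + 1) * (j + 1)) := by
          rw [pow_add, ENNReal.mul_inv (Or.inl (pow_ne_zero _ h0))
            (Or.inl (ENNReal.pow_ne_top htop)), hy, mul_pow, ENNReal.inv_pow, ENNReal.inv_pow]
          ring
      _ ≤ C * (lam ^ n)⁻¹ * y ^ (1 + (j + k)) := by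
          have h1 : 1 + (j + k) ≤ (k + 1) * (j + 1) := by nlinarith
          exact mul_le_mul_right (pow_le_pow_of_le_one zero_le hy3 h1) _
      _ = _ := by ring
  calc _ ≤ ∑' j : ℕ, ∑' k : ℕ, (C * (lam ^ n)⁻¹ * y) * (y ^ j * y ^ k) :=
        ENNReal.tsum_le_tsum fun j => ENNReal.tsum_le_tsum fun k => term j k
    _ = (C * (lam ^ n)⁻¹ * y) * ((1 - y)⁻¹ * (1 - y)⁻¹) := by
        simp only [ENNReal.tsum_mul_left, ENNReal.tsum_mul_right, ENNReal.tsum_geometric]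
    _ ≤ (C * (lam ^ n)⁻¹ * y) * (2 * 2) := by gcongr
    _ = (8 * 8⁻¹) * ((C * (lam ^ n)⁻¹ * y) * (2 * 2)) := by
        rw [ENNReal.mul_inv_cancel (by norm_num) (by norm_num), one_mul]
    _ = 8⁻¹ * (lam ^ n)⁻¹ * (32 * C * y) := by ring
    _ ≤ 8⁻¹ * (lam ^ n)⁻¹ * 1 := by
        gcongr
        refine le_trans ?_ hy1
        gcongr
        exact le_self_add
    _ = _ := mul_one _

lemma exists_base {d : ℝ} (h1 : 1 < d) (h2 : d < 2) (C : ℝ) :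
    ∃ R : ℕ, 2 ≤ R ∧ 2 * (R : ℝ) ^ d ≤ (R : ℝ) ^ 2 ∧ R * C ≤ (R : ℝ) ^ d := by
  have t1 := (tendsto_rpow_atTop (show 0 < 2 - d by linarith)).comp
    (tendsto_natCast_atTop_atTop (R := ℝ))
  have t2 := (tendsto_rpow_atTop (show 0 < d - 1 by linarith)).comp
    (tendsto_natCast_atTop_atTop (R := ℝ))
  obtain ⟨R, ⟨hR1, hR2⟩, hR3⟩ := (((t1.eventually_ge_atTop 2).and
    (t2.eventually_ge_atTop C)).and (Filter.eventually_ge_atTop 2)).exists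
  have hR0 : (0 : ℝ) < R := by exact_mod_cast (by omega : 0 < R)
  refine ⟨R, hR3, ?_, ?_⟩
  · calc 2 * (R : ℝ) ^ d ≤ (R : ℝ) ^ (2 - d) * (R : ℝ) ^ d := by
          have : (2 : ℝ) ≤ (R : ℝ) ^ (2 - d) := hR1
          gcongr
      _ = (R : ℝ) ^ 2 := by rw [← Real.rpow_add hR0, sub_add_cancel, Real.rpow_two]
  · calc R * C ≤ R * (R : ℝ) ^ (d - 1) := by
          have : C ≤ (R : ℝ) ^ (d - 1) := hR2
          gcongr
      _ = (R : ℝ) ^ d := by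
          rw [← Real.rpow_one_add' hR0.le (by linarith), add_sub_cancel]

theorem hausdorffMeasure_iInter_image_ne_zero {S : ℕ → Set (EuclideanSpace ℝ (Fin 2))}
    (hS : ∀ j, StripProperty (S j)) {M : ℝ} (hM : 1 ≤ M)
    (f : ℕ → EuclideanSpace ℝ (Fin 2) ≃ₜ EuclideanSpace ℝ (Fin 2))
    (hf : ∀ j x y, M⁻¹ * ‖x - y‖ ≤ ‖f j x - f j y‖ ∧ ‖f j x - f j y‖ ≤ M * ‖x - y‖)
    {d : ℝ} (hd1 : 1 < d) (hd2 : d < 2) : μH[d] (⋂ j, f j '' S j) ≠ 0 := by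
  intro hzero
  set C := stripConst M with hC
  obtain ⟨R, hR, hR1, hR2⟩ := exists_base hd1 hd2 (32 * C + 2)
  have hR0 : 0 < R := by omega
  have hRr : (0 : ℝ) < R := by exact_mod_cast hR0
  set lam := ENNReal.ofReal ((R : ℝ) ^ d) with hlam
  have hlam0 : lam ≠ 0 := by
    rw [hlam, Ne, ENNReal.ofReal_eq_zero, not_le]; positivity
  have hlamtop : lam ≠ ∞ := ENNReal.ofReal_ne_top
  have hlam1 : 2 * lam ≤ (R : ℝ≥0∞) ^ 2 := by
    have := ENNReal.ofReal_le_ofReal hR1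
    rwa [ENNReal.ofReal_mul (by norm_num), ENNReal.ofReal_pow hRr.le, ENNReal.ofReal_natCast,
      ENNReal.ofReal_ofNat] at this
  have hlam2 : (R : ℝ≥0∞) * (32 * C + 2) ≤ lam := by
    have := ENNReal.ofReal_le_ofReal hR2
    rwa [ENNReal.ofReal_mul hRr.le, ENNReal.ofReal_natCast, ENNReal.ofReal_add (by positivity)
      (by norm_num), ENNReal.ofReal_mul (by norm_num), ENNReal.ofReal_natCast,
      ENNReal.ofReal_ofNat, ENNReal.ofReal_ofNat] at this
  let ν : Measure (ℕ × ℤ × ℤ) := Measure.sum fun p => (lam ^ p.1)⁻¹ • Measure.dirac p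
  have hν : ∀ N c, ν {(N, c)} = (lam ^ N)⁻¹ := fun N c => Measure.sum_smul_dirac_singleton
  obtain ⟨O, hO, hOav⟩ := exists_cover_obstacles hd1.le hR ν hν hzero (δ := 8⁻¹) (by simp)
  have hgame := fun j => (hS j).exists_obstacles hM (f j) (hf j) hR j.succ_pos ν hν
  choose G hG hGav using hgame
  -- The cover is revealed at the initial cell.
  let Obs : ℕ → ℤ × ℤ → Set (ℕ × ℤ × ℤ) := fun n c => (⋃ j, G j n c) ∪ {p | n = 0 ∧ p ∈ O}
  have hObs : ∀ n c, ν (Obs n c ∩ cellsBelow R n c) ≤ 4⁻¹ * (lam ^ n)⁻¹ := by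
    intro n c
    have h1 : ν (⋃ j, G j n c) ≤ 8⁻¹ * (lam ^ n)⁻¹ := by
      refine (measure_iUnion_le _).trans (le_trans (ENNReal.tsum_le_tsum fun j => ?_)
        (tsum_obstacles_le hlam0 hlamtop C hlam2 n))
      refine (hG j n c).trans_eq ?_
      push_cast
      rfl
    have h2 : ν {p | n = 0 ∧ p ∈ O} ≤ 8⁻¹ * (lam ^ n)⁻¹ := by
      rcases Nat.eq_zero_or_pos n with rfl | hn
      · simpa using hO
      · have : {p : ℕ × ℤ × ℤ | n = 0 ∧ p ∈ O} = ∅ := by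
          ext p
          exact ⟨fun hp => hn.ne' hp.1, fun hp => hp.elim⟩
        rw [this, measure_empty]
        exact zero_le
    have h8 : (8 : ℝ≥0∞)⁻¹ + 8⁻¹ = 4⁻¹ := by
      have : (8 : ℝ≥0∞) = 2 * 4 := by norm_num
      rw [this, ENNReal.mul_inv (by simp) (by simp), ← add_mul, ENNReal.inv_two_add_inv_two,
        one_mul]
    calc _ ≤ ν (Obs n c) := measure_mono Set.inter_subset_left
      _ ≤ _ := measure_union_le _ _
      _ ≤ 8⁻¹ * (lam ^ n)⁻¹ + 8⁻¹ * (lam ^ n)⁻¹ := add_le_add h1 h2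
      _ = _ := by rw [← add_mul, h8]
  obtain ⟨c, hc, hav⟩ := exists_path_avoiding hR0 hlam0 hlamtop hlam1 ν hν Obs hObs
  obtain ⟨x, hx⟩ := IsCompact.nonempty_iInter_of_sequence_nonempty_isCompact_isClosed
    (fun n => cell ((R : ℝ) ^ n)⁻¹ (c n)) (fun n => cell_subset_cell hR0 (hc n).1 (hc n).2)
    (fun n => nonempty_cell (by positivity) _) (isCompact_cell _ _) (fun n => isClosed_cell _ _)
  rw [Set.mem_iInter] at hx
  refine hOav c (fun N hN hmem => hav 0 N hN (Or.inr ⟨rfl, hmem⟩)) x hx ?_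
  exact Set.mem_iInter.mpr fun j => hGav j c hc
    (fun n N h hmem => hav n N h (Or.inl (Set.mem_iUnion.mpr ⟨j, hmem⟩))) x hx

theorem dimH_iInter_image_eq_two {S : ℕ → Set (EuclideanSpace ℝ (Fin 2))}
    (hS : ∀ j, StripProperty (S j)) {M : ℝ} (hM : 1 ≤ M)
    (f : ℕ → EuclideanSpace ℝ (Fin 2) ≃ₜ EuclideanSpace ℝ (Fin 2))
    (hf : ∀ j x y, M⁻¹ * ‖x - y‖ ≤ ‖f j x - f j y‖ ∧ ‖f j x - f j y‖ ≤ M * ‖x - y‖) :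
    dimH (⋂ j, f j '' S j) = 2 := by
  apply le_antisymm
  · refine (dimH_mono (Set.subset_univ _)).trans_eq ?_
    rw [Real.dimH_univ_eq_finrank, finrank_euclideanSpace_fin]
    norm_num
  · by_contra! hlt
    obtain ⟨d, h1, h2⟩ := ENNReal.lt_iff_exists_nnreal_btwn.mp
      (max_lt hlt (show (1 : ℝ≥0∞) < 2 by norm_num))
    have hd1 : (1 : ℝ) < d := by exact_mod_cast (le_max_right _ _).trans_lt h1
    have hd2 : (d : ℝ) < 2 := by exact_mod_cast h2
    have h3 := le_dimH_of_hausdorffMeasure_ne_zero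
      (hausdorffMeasure_iInter_image_ne_zero hS hM f hf hd1 hd2)
    exact (((le_max_left _ _).trans_lt h1).trans_le h3).false

theorem mainTheorem2 :
    (∀ (s t : ℕ → ℝ), (∀ n, 0 ≤ s n) → (∀ n, 0 ≤ t n) → (∀ n, s n + t n = 1) →
      ∀ (f : ℕ → EuclideanSpace ℝ (Fin 2) ≃ₜ EuclideanSpace ℝ (Fin 2)) (M : ℝ), 1 ≤ M →
        (∀ (n : ℕ) (x₁ x₂ : EuclideanSpace ℝ (Fin 2)),
          M⁻¹ * ‖x₁ - x₂‖ ≤ ‖f n x₁ - f n x₂‖ ∧ ‖f n x₁ - f n x₂‖ ≤ M * ‖x₁ - x₂‖) →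
        dimH (⋂ n, f n '' Bad (s n) (t n)) = 2) ∧
    (Bad (1 / 3) (2 / 3) ∩ Bad (2 / 3) (1 / 3)).Nonempty := by
  refine ⟨fun s t hs ht hst f M hM hf =>
    dimH_iInter_image_eq_two (fun n => stripProperty_Bad (hs n) (ht n) (hst n)) hM f hf, ?_⟩
  -- A set of dimension `2` is not empty.
  have h := dimH_iInter_image_eq_two
    (S := fun n : ℕ => Bad (if n = 0 then 1 / 3 else 2 / 3) (if n = 0 then 2 / 3 else 1 / 3))
    (fun n => stripProperty_Bad (by positivity) (by positivity) (by split_ifs <;> norm_num))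
    le_rfl (fun _ => Homeomorph.refl _) (fun n x y => by simp)
  obtain ⟨x, hx⟩ : (⋂ n : ℕ, Homeomorph.refl (EuclideanSpace ℝ (Fin 2)) ''
      Bad (if n = 0 then 1 / 3 else 2 / 3) (if n = 0 then 2 / 3 else 1 / 3)).Nonempty := by
    rw [Set.nonempty_iff_ne_empty]
    intro he
    rw [he, dimH_empty] at h
    norm_num at h
  have h0 := Set.mem_iInter.mp hx 0
  have h1 := Set.mem_iInter.mp hx 1
  exact ⟨x, by simpa using h0, by simpa using h1⟩
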